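/- Let $L/K$ be an extension of number fields and let $M$ be the normal closure of $L/K$. A nonzero prime $\mathfrak p$ of $\mathcal O_K$ splits completely in a finite extension $F/K$ if every prime of $\mathcal O_F$ above $\mathfrak p$ has ramification index $1$ and inertia degree $1$ over $\mathfrak p$. For a set $\mathcal A$ of nonzero primes of $\mathcal O_K$ put $$\zeta_{K,\mathcal A}(s)=\prod_{\mathfrak p\in\mathcal A}\left(1-\frac1{N(\mathfrak p)^{s}}\right)^{-1},\qquad \operatorname{Re}(s)>1,$$ where $N(\mathfrak p)=|\mathcal O_K/\mathfrak p|$. The set $\mathcal A$ has polar density $m/n$ if, for some integers $n\ge1$ and $m\ge0$, the function $\zeta_{K,\mathcal A}^{\,n}$ extends to a meromorphic function in a neighbourhood of $s=1$ having a pole of order exactly $m$ at $s=1$ (for $m=0$: neither a pole nor a zero). Then the set of nonzero primes of $\mathcal O_K$ that split completely in $M$ has polar density $\dfrac{1}{[M:K]}$. Moreover, a nonzero prime of $\mathcal O_K$ splits completely in $L$ if and only if it splits completely in $M$. -/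

import Mathlib

open IsDedekindDomain Filter Topology
open scoped NumberField

/-- A nonzero prime `𝔭` of `𝓞 K` splits completely in the extension `L` of `K`: every prime `𝔓` of
`𝓞 L` above `𝔭` has ramification index and inertia degree equal to `1` over `K`. -/
def SplitsCompletely {K : Type*} [Field K] (L : Type*) [Field L] [Algebra K L]
    (𝔭 : HeightOneSpectrum (𝓞 K)) : Prop :=
  ∀ 𝔓 ∈ 𝔭.asIdeal.primesOver (𝓞 L),
    𝔓.ramificationIdx (𝓞 K) = 1 ∧ 𝔓.inertiaDeg (𝓞 K) = 1

/-- The partial Dedekind zeta function `∏_{𝔭 ∈ A} (1 - N(𝔭)⁻ˢ)⁻¹` of a set `A` of nonzero primes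
of `𝓞 K`; the product converges absolutely for `Re s > 1`, and only such `s` are used below. -/
noncomputable def partialDedekindZeta {K : Type*} [Field K] [NumberField K]
    (A : Set (HeightOneSpectrum (𝓞 K))) (s : ℂ) : ℂ :=
  ∏' 𝔭 : A, (1 - (Ideal.absNorm 𝔭.1.asIdeal : ℂ) ^ (-s))⁻¹

/-- The set `A` of nonzero primes of `𝓞 K` has polar density `d`: for some `n ≥ 1` the `n`-th power
of the partial zeta function of `A`, defined on `Re s > 1`, extends to a function `f` that is
meromorphic in a neighbourhood of `1` and has a pole of order `m` at `1`, where `d = m / n`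
(for `m = 0` this means that `f` has neither a pole nor a zero at `1`). -/
def HasPolarDensity {K : Type*} [Field K] [NumberField K]
    (A : Set (HeightOneSpectrum (𝓞 K))) (d : ℚ) : Prop :=
  ∃ n m : ℕ, 1 ≤ n ∧ d = (m : ℚ) / (n : ℚ) ∧
    ∃ f : ℂ → ℂ, MeromorphicAt f 1 ∧
      meromorphicOrderAt f 1 = ((-(m : ℤ) : ℤ) : WithTop ℤ) ∧
      ∀ᶠ s in 𝓝[{s : ℂ | 1 < s.re}] 1, f s = partialDedekindZeta A s ^ n

/-! Density. In the Euler product of the Dedekind zeta function of M, the primes that are ramified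
over K or have inertia degree at least 2 contribute a factor h that is holomorphic and nonzero on Re
s > 3/4 (`summable_absNorm_rpow_compl_degreeOnePrimes`, `exists_differentiableOn_hasProd`). As M/K
is Galois, the remaining primes are those above completely split primes of K, [M:K] above each and
with the same norm. Hence the [M:K]-th power of the partial zeta function is ζ_M / h
(`hasProd_split`), and it has a simple pole at 1 because ζ_M has one.

The pole of ζ_M (`exists_meromorphicAt_idealZeta`). The ideals of a fixed class correspond to the
nonzero elements of a lattice J modulo units. Instead of choosing a fundamental domain, one weights
the elements by a Lipschitz function of their logarithmic vector whose translates under the units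
sum to 1. With n the degree of the field, multiplying the weighted sum by 1 - 2^(n - ns) compares
the 2^n cosets of 2J with 2J itself; the differences of nearby terms decay fast enough to converge
to the left of 1 (`exists_differentiableOn_eq_zeta`). The factor has a simple zero at 1, so the pole
is at most simple, and the class number formula shows that it is present.

Splitting in L and M (`splitsCompletely_iff_of_isNormalClosure`). If a prime splits completely in L,
the decomposition group of any prime of M above it fixes every conjugate of L. These generate M, so
the group is trivial, and its order is the product of ramification index and inertia degree. The
converse is multiplicativity in towers. -/

/-! ### A Lipschitz partition of unity for the action of the units -/

/-- Let a group `U` act on a normed space by translations, properly discontinuously and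
cocompactly. There is a compactly supported Lipschitz function whose translates sum to `1`. -/
theorem exists_lipschitz_sum_translates_eq_one {V U : Type*} [NormedAddCommGroup V] [AddCommGroup U]
    (l : U →+ V) (hfin : ∀ r : ℝ, {u | ‖l u‖ ≤ r}.Finite)
    (hcov : ∃ R : ℝ, ∀ y, ∃ u, ‖l u + y‖ ≤ R) :
    ∃ (φ : V → ℝ) (B c : ℝ), 0 ≤ B ∧ 0 ≤ c ∧ (∀ y, 0 ≤ φ y ∧ φ y ≤ 1) ∧
      (∀ y, φ y ≠ 0 → ‖y‖ ≤ B) ∧ (∀ y z, |φ y - φ z| ≤ c * ‖y - z‖) ∧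
      ∀ y, HasSum (fun u ↦ φ (l u + y)) 1 := by
  obtain ⟨R₀, hR₀⟩ := hcov
  -- The extra 1 makes the tent function `t` at least 1 somewhere on every orbit, so the orbit sum
  -- `S` is at least 1 and dividing by it preserves Lipschitz bounds.
  set R := max R₀ 0 + 1 with hR
  have hRpos : 0 < R := by positivity
  let t : V → ℝ := fun y ↦ max 0 (R - ‖y‖)
  have ht0 : ∀ y, 0 ≤ t y := fun y ↦ le_max_left _ _
  have htR : ∀ y, t y ≤ R := fun y ↦ max_le hRpos.le (by linarith [norm_nonneg y])
  have htsupp : ∀ y, t y ≠ 0 → ‖y‖ ≤ R := by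
    intro y hy
    by_contra! h
    exact hy (max_eq_left (by linarith))
  have htlip : ∀ y z, |t y - t z| ≤ ‖y - z‖ := by
    intro y z
    refine (abs_max_sub_max_le_max _ _ _ _).trans ?_
    rw [sub_self, abs_zero, sub_sub_sub_cancel_left]
    exact max_le (norm_nonneg _) (by rw [norm_sub_rev]; exact abs_norm_sub_norm_le _ _)
  -- Two translates of one point that both lie in the ball of radius R differ by some l u of norm at
  -- most 2R. So at most N terms of an orbit sum are nonzero, uniformly in the point.
  set F := (hfin (2 * R)).toFinset with hF
  set N : ℝ := (F.card : ℝ) with hN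
  have hloc : ∀ y, ∃ T : Finset U, (T.card : ℝ) ≤ N ∧ ∀ u ∉ T, t (l u + y) = 0 := by
    classical
    intro y
    by_cases h : ∃ u₀, t (l u₀ + y) ≠ 0
    · obtain ⟨u₀, hu₀⟩ := h
      refine ⟨F.image (· + u₀), Nat.cast_le.mpr Finset.card_image_le, fun u hu ↦ ?_⟩
      by_contra hne
      refine hu (Finset.mem_image.mpr ⟨u - u₀, ?_, sub_add_cancel _ _⟩)
      rw [hF, Set.Finite.mem_toFinset, Set.mem_ofPred_eq, map_sub,
        ← add_sub_add_right_eq_sub _ _ y]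
      have := norm_sub_le (l u + y) (l u₀ + y)
      linarith [htsupp _ hne, htsupp _ hu₀]
    · push Not at h
      exact ⟨∅, by simp [hN], fun u _ ↦ h u⟩
  let S : V → ℝ := fun y ↦ ∑' u, t (l u + y)
  have hsum : ∀ y, Summable fun u ↦ t (l u + y) := fun y ↦ by
    obtain ⟨T, -, hT⟩ := hloc y
    exact summable_of_ne_finset_zero hT
  have hS1 : ∀ y, 1 ≤ S y := by
    intro y
    obtain ⟨u, hu⟩ := hR₀ y
    refine le_trans ?_ ((hsum y).le_tsum u fun v _ ↦ ht0 _)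
    refine le_max_of_le_right ?_
    have := le_max_left R₀ 0
    linarith
  have hSinv : ∀ v y, S (l v + y) = S y := by
    intro v y
    have := (Equiv.addRight v).tsum_eq (fun u ↦ t (l u + y))
    simpa only [Equiv.coe_addRight, map_add, add_assoc] using this
  have hSlip : ∀ y z, |S y - S z| ≤ 2 * N * ‖y - z‖ := by
    classical
    intro y z
    obtain ⟨T₁, hT₁, hT₁'⟩ := hloc y
    obtain ⟨T₂, hT₂, hT₂'⟩ := hloc z
    have e₁ : S y = ∑ u ∈ T₁ ∪ T₂, t (l u + y) :=
      tsum_eq_sum fun u hu ↦ hT₁' u fun h ↦ hu (Finset.mem_union_left _ h)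
    have e₂ : S z = ∑ u ∈ T₁ ∪ T₂, t (l u + z) :=
      tsum_eq_sum fun u hu ↦ hT₂' u fun h ↦ hu (Finset.mem_union_right _ h)
    rw [e₁, e₂, ← Finset.sum_sub_distrib]
    calc _ ≤ ∑ u ∈ T₁ ∪ T₂, |t (l u + y) - t (l u + z)| := Finset.abs_sum_le_sum_abs _ _
      _ ≤ ∑ u ∈ T₁ ∪ T₂, ‖y - z‖ := Finset.sum_le_sum fun u _ ↦ by
          simpa using htlip (l u + y) (l u + z)
      _ = ((T₁ ∪ T₂).card : ℝ) * ‖y - z‖ := by simp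
      _ ≤ _ := by
          have : ((T₁ ∪ T₂).card : ℝ) ≤ T₁.card + T₂.card := by
            exact_mod_cast Finset.card_union_le _ _
          gcongr
          linarith
  have hSpos : ∀ y, 0 < S y := fun y ↦ zero_lt_one.trans_le (hS1 y)
  refine ⟨fun y ↦ t y / S y, R, 1 + R * (2 * N), hRpos.le, by positivity, fun y ↦ ⟨?_, ?_⟩,
    fun y hy ↦ ?_, fun y z ↦ ?_, fun y ↦ ?_⟩
  · exact div_nonneg (ht0 y) (hSpos y).le
  · rw [div_le_one (hSpos y)]
    simpa using (hsum y).le_tsum 0 fun v _ ↦ ht0 _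
  · exact htsupp y (left_ne_zero_of_mul (by simpa only [div_eq_mul_inv] using hy))
  · have e : t y / S y - t z / S z = (t y - t z) / S y + t z * ((S z - S y) / (S y * S z)) := by
      have := (hSpos y).ne'
      have := (hSpos z).ne'
      field_simp
      ring
    have h₁ : |(t y - t z) / S y| ≤ ‖y - z‖ := by
      rw [abs_div, abs_of_pos (hSpos y)]
      exact (div_le_self (abs_nonneg _) (hS1 y)).trans (htlip y z)
    have h₂ : |(S z - S y) / (S y * S z)| ≤ 2 * N * ‖y - z‖ := by
      rw [abs_div, abs_of_pos (mul_pos (hSpos y) (hSpos z)), abs_sub_comm]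
      exact (div_le_self (abs_nonneg _) (one_le_mul_of_one_le_of_one_le (hS1 y) (hS1 z))).trans
        (hSlip y z)
    have h₃ : |t z| ≤ R := by rw [abs_of_nonneg (ht0 z)]; exact htR z
    simp only [e]
    calc _ ≤ |(t y - t z) / S y| + |t z| * |(S z - S y) / (S y * S z)| := by
          rw [← abs_mul]; exact abs_add_le _ _
      _ ≤ ‖y - z‖ + R * (2 * N * ‖y - z‖) := by gcongr
      _ = _ := by ring
  · simp only [hSinv]
    have := ((hsum y).hasSum).div_const (S y)
    rwa [div_self (hSpos y).ne'] at this

namespace NumberField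

open NumberField.Units NumberField.Units.dirichletUnitTheorem

variable (K : Type*) [Field K] [NumberField K]

theorem finite_units_abs_le (r : ℝ) : {u : (𝓞 K)ˣ | ∀ w : InfinitePlace K, w (u : K) ≤ r}.Finite := by
  have h := NumberField.Embeddings.finite_of_norm_le K ℂ r
  refine Set.Finite.of_finite_image (f := fun u : (𝓞 K)ˣ ↦ ((u : 𝓞 K) : K)) (h.subset ?_) ?_
  · rintro _ ⟨u, hu, rfl⟩
    exact ⟨RingOfIntegers.isIntegral_coe _, fun φ ↦ hu (InfinitePlace.mk φ)⟩
  · intro u _ v _ h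
    exact Units.ext (RingOfIntegers.ext h)

/-- There is a compactly supported Lipschitz function on the logarithmic space whose translates
under the units sum to `1`. -/
theorem exists_lipschitz_sum_units_eq_one :
    ∃ (φ : logSpace K → ℝ) (B c : ℝ), 0 ≤ B ∧ 0 ≤ c ∧ (∀ y, 0 ≤ φ y ∧ φ y ≤ 1) ∧
      (∀ y, φ y ≠ 0 → ∀ w, |y w| ≤ B) ∧
      (∀ y z δ, 0 ≤ δ → (∀ w, |y w - z w| ≤ δ) → |φ y - φ z| ≤ c * δ) ∧
      ∀ y, HasSum (fun u : (𝓞 K)ˣ ↦ φ (logEmbedding K (Additive.ofMul u) + y)) 1 := by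
  classical
  have hfin : ∀ r : ℝ, {u | ‖logEmbedding K u‖ ≤ r}.Finite := by
    intro r
    rcases lt_or_ge r 0 with hr | hr
    · convert! Set.finite_empty
      ext u
      simpa using hr.trans_le (norm_nonneg _)
    · refine (finite_units_abs_le K (Real.exp (Fintype.card (InfinitePlace K) * r))).subset
        fun u hu w ↦ ?_
      rw [← Real.log_le_iff_le_exp (Units.pos_at_place _ _)]
      exact (le_abs_self _).trans (log_le_of_logEmbedding_le hr hu w)
  -- By Dirichlet's unit theorem the unit lattice is a full lattice, so every point can be moved
  -- into a fundamental parallelepiped.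
  have hcov : ∃ R : ℝ, ∀ y, ∃ u, ‖logEmbedding K u + y‖ ≤ R := by
    let b := (basisUnitLattice K).ofZLatticeBasis ℝ (unitLattice K)
    refine ⟨∑ i, ‖b i‖, fun y ↦ ?_⟩
    have h : ((ZSpan.floor b y : Submodule.span ℤ (Set.range b)) : logSpace K) ∈ unitLattice K := by
      rw [← (basisUnitLattice K).ofZLatticeBasis_span ℝ (unitLattice K)]
      exact (ZSpan.floor b y).2
    obtain ⟨u, -, hu⟩ := h
    refine ⟨-u, ?_⟩
    have : logEmbedding K u = ZSpan.floor b y := hu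
    rw [map_neg, this, neg_add_eq_sub]
    exact ZSpan.norm_fract_le b y
  obtain ⟨φ, B, c, hB, hc, h01, hsupp, hlip, hsum⟩ :=
    exists_lipschitz_sum_translates_eq_one (logEmbedding K) hfin hcov
  refine ⟨φ, B, c, hB, hc, h01, fun y hy w ↦ ?_, fun y z δ hδ h ↦ ?_, hsum⟩
  · exact (norm_le_pi_norm y w).trans (hsupp y hy)
  · refine (hlip y z).trans (mul_le_mul_of_nonneg_left ?_ hc)
    exact (pi_norm_le_iff_of_nonneg hδ).mpr h

end NumberField

/-! ### Weighted terms on the mixed space and their variation -/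

namespace NumberField

open NumberField.Units NumberField.Units.dirichletUnitTheorem mixedEmbedding InfinitePlace

variable (K : Type*) [Field K] [NumberField K]

/-- A compactly supported Lipschitz function on the logarithmic space whose translates under the
units sum to `1`. -/
structure UnitPartition where
  /-- the function -/
  toFun : logSpace K → ℝ
  /-- a bound for the support -/
  bound : ℝ
  /-- a Lipschitz constant -/
  lip : ℝ
  bound_nonneg : 0 ≤ bound
  lip_nonneg : 0 ≤ lip
  nonneg : ∀ y, 0 ≤ toFun y
  le_one : ∀ y, toFun y ≤ 1
  abs_le_bound : ∀ y, toFun y ≠ 0 → ∀ w, |y w| ≤ bound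
  abs_sub_le : ∀ y z δ, 0 ≤ δ → (∀ w, |y w - z w| ≤ δ) → |toFun y - toFun z| ≤ lip * δ
  hasSum : ∀ y, HasSum (fun u : (𝓞 K)ˣ ↦ toFun (logEmbedding K (Additive.ofMul u) + y)) 1

instance : Nonempty (UnitPartition K) := by
  obtain ⟨φ, B, c, hB, hc, h01, hsupp, hlip, hsum⟩ := exists_lipschitz_sum_units_eq_one K
  exact ⟨⟨φ, B, c, hB, hc, fun y ↦ (h01 y).1, fun y ↦ (h01 y).2, hsupp, hlip, hsum⟩⟩

variable {K}

theorem log_norm_eq_sum {x : mixedSpace K} (hx : mixedEmbedding.norm x ≠ 0) :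
    Real.log (mixedEmbedding.norm x) = ∑ w, (mult w : ℝ) * Real.log (normAtPlace w x) := by
  rw [mixedEmbedding.norm_apply, Real.log_prod]
  · simp [Real.log_pow]
  · exact fun w _ ↦ pow_ne_zero _ (mixedEmbedding.norm_ne_zero_iff.mp hx w)

theorem sum_mult_eq_finrank : ∑ w : InfinitePlace K, (mult w : ℝ) = Module.finrank ℚ K := by
  exact_mod_cast sum_mult_eq (K := K)

theorem one_le_mult_real {K : Type*} [Field K] (w : InfinitePlace K) : (1 : ℝ) ≤ mult w := by
  exact_mod_cast one_le_mult

theorem mult_le_two_real {K : Type*} [Field K] (w : InfinitePlace K) : (mult w : ℝ) ≤ 2 := by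
  rw [mult]; split_ifs <;> norm_num

theorem finrank_rat_pos_real : (0 : ℝ) < Module.finrank ℚ K := by
  exact_mod_cast Module.finrank_pos

/-- If the logarithmic vector of `x` is bounded, then all absolute values of `x` are of the same
size. -/
theorem abs_log_normAtPlace_sub_le {x : mixedSpace K} (hx : mixedEmbedding.norm x ≠ 0) {B : ℝ}
    (hB : 0 ≤ B) (h : ∀ w, |logMap x w| ≤ B) (w : InfinitePlace K) :
    |Real.log (normAtPlace w x) - Real.log (mixedEmbedding.norm x) * (Module.finrank ℚ K : ℝ)⁻¹| ≤
      Fintype.card (InfinitePlace K) * B := by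
  classical
  set ν := Real.log (mixedEmbedding.norm x) * (Module.finrank ℚ K : ℝ)⁻¹ with hν
  have hcard : (1 : ℝ) ≤ Fintype.card (InfinitePlace K) := by
    exact_mod_cast Fintype.card_pos
  have key : ∀ v : {w : InfinitePlace K // w ≠ w₀},
      |(mult v.1 : ℝ) * (Real.log (normAtPlace v.1 x) - ν)| ≤ B := h
  have le_of : ∀ (v : InfinitePlace K) (t M : ℝ), |(mult v : ℝ) * t| ≤ M → |t| ≤ M := by
    intro v t M hM
    refine le_trans ?_ hM
    rw [abs_mul, abs_of_nonneg (by positivity : (0 : ℝ) ≤ mult v)]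
    exact le_mul_of_one_le_left (abs_nonneg _) (one_le_mult_real v)
  by_cases hw : w = w₀
  · subst hw
    apply le_of w₀
    -- The logarithmic vector omits the place w₀. The weighted deviations from the mean sum to 0, so
    -- the one at w₀ is controlled by the others.
    have hsum : ∑ v, (mult v : ℝ) * (Real.log (normAtPlace v x) - ν) = 0 := by
      simp_rw [mul_sub]
      rw [Finset.sum_sub_distrib, ← log_norm_eq_sum hx, ← Finset.sum_mul, sum_mult_eq_finrank, hν]
      field_simp [(finrank_rat_pos_real (K := K)).ne']
      ring
    rw [Fintype.sum_eq_add_sum_subtype_ne _ w₀] at hsum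
    rw [eq_neg_of_add_eq_zero_left hsum, abs_neg]
    refine (Finset.abs_sum_le_sum_abs _ _).trans ((Finset.sum_le_sum fun v _ ↦ key v).trans ?_)
    simp only [Finset.sum_const, nsmul_eq_mul]
    gcongr
    exact_mod_cast Fintype.card_subtype_le _
  · exact (le_of w _ _ (key ⟨w, hw⟩)).trans (le_mul_of_one_le_left hB hcard)

/-- Closeness of all absolute values, up to a factor `exp ε`, bounds the differences of the
logarithms of the norms and of the logarithmic vectors. -/
theorem abs_log_norm_sub_le {x y : mixedSpace K} (hx : mixedEmbedding.norm x ≠ 0)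
    (hy : mixedEmbedding.norm y ≠ 0) {ε : ℝ}
    (h : ∀ w, |Real.log (normAtPlace w x) - Real.log (normAtPlace w y)| ≤ ε) :
    |Real.log (mixedEmbedding.norm x) - Real.log (mixedEmbedding.norm y)| ≤
      Module.finrank ℚ K * ε := by
  rw [log_norm_eq_sum hx, log_norm_eq_sum hy, ← Finset.sum_sub_distrib, ← sum_mult_eq_finrank,
    Finset.sum_mul]
  refine (Finset.abs_sum_le_sum_abs _ _).trans (Finset.sum_le_sum fun w _ ↦ ?_)
  rw [← mul_sub, abs_mul, abs_of_nonneg (by positivity : (0 : ℝ) ≤ mult w)]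
  gcongr
  exact h w

theorem abs_logMap_sub_le {x y : mixedSpace K} (hx : mixedEmbedding.norm x ≠ 0)
    (hy : mixedEmbedding.norm y ≠ 0) {ε : ℝ}
    (h : ∀ w, |Real.log (normAtPlace w x) - Real.log (normAtPlace w y)| ≤ ε)
    (w : {w : InfinitePlace K // w ≠ w₀}) : |logMap x w - logMap y w| ≤ 4 * ε := by
  have hn := finrank_rat_pos_real (K := K)
  have hε : 0 ≤ ε := (abs_nonneg _).trans (h w.1)
  rw [logMap_apply, logMap_apply, ← mul_sub, abs_mul, abs_of_nonneg (by positivity), sub_sub_sub_comm,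
    ← sub_mul]
  have h₁ : |(Real.log (mixedEmbedding.norm x) - Real.log (mixedEmbedding.norm y)) *
      (Module.finrank ℚ K : ℝ)⁻¹| ≤ ε := by
    rw [abs_mul, abs_of_pos (inv_pos.mpr hn), mul_inv_le_iff₀ hn, mul_comm ε]
    exact abs_log_norm_sub_le hx hy h
  calc _ ≤ 2 * (ε + ε) := by
        gcongr
        · exact mult_le_two_real w.1
        · exact (abs_sub _ _).trans (add_le_add (h w.1) h₁)
    _ = _ := by ring

open scoped Classical in
theorem normAtPlace_le_norm (x : mixedSpace K) (w : InfinitePlace K) : normAtPlace w x ≤ ‖x‖ := by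
  rw [norm_eq_sup'_normAtPlace]
  exact Finset.le_sup' (fun w ↦ normAtPlace w x) (Finset.mem_univ w)

open scoped Classical in
theorem exists_normAtPlace_eq_norm (x : mixedSpace K) : ∃ w, normAtPlace w x = ‖x‖ := by
  rw [norm_eq_sup'_normAtPlace]
  obtain ⟨w, -, hw⟩ := Finset.exists_mem_eq_sup' Finset.univ_nonempty (fun w ↦ normAtPlace w x)
  exact ⟨w, hw.symm⟩

open scoped Classical in
theorem abs_normAtPlace_sub_le (x y : mixedSpace K) (w : InfinitePlace K) :
    |normAtPlace w x - normAtPlace w y| ≤ ‖x - y‖ := by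
  rw [abs_le]
  constructor
  · have := normAtPlace_add_le w x (y - x)
    rw [add_sub_cancel] at this
    have h := normAtPlace_le_norm (y - x) w
    rw [norm_sub_rev] at h
    linarith
  · have := normAtPlace_add_le w y (x - y)
    rw [add_sub_cancel] at this
    linarith [normAtPlace_le_norm (x - y) w]

theorem abs_log_sub_log_le {a b m : ℝ} (hm : 0 < m) (ha : m ≤ a) (hb : m ≤ b) :
    |Real.log a - Real.log b| ≤ |a - b| / m := by
  have key : ∀ {a b : ℝ}, m ≤ a → m ≤ b → Real.log a - Real.log b ≤ |a - b| / m := by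
    intro a b ha hb
    have ha' := hm.trans_le ha
    have hb' := hm.trans_le hb
    rw [← Real.log_div ha'.ne' hb'.ne']
    calc _ ≤ a / b - 1 := Real.log_le_sub_one_of_pos (div_pos ha' hb')
      _ = (a - b) / b := by field_simp
      _ ≤ |a - b| / b := by gcongr; exact le_abs_self _
      _ ≤ _ := by gcongr
  rw [abs_le]
  refine ⟨?_, key ha hb⟩
  have := key hb ha
  rw [abs_sub_comm] at this
  linarith

/-- The quotient of the two powers is exp z with z = s (log a - log b), and |exp z - 1| ≤ 2 |z| for
|z| ≤ 1. -/
theorem norm_cpow_neg_sub_le {a b : ℝ} (ha : 0 < a) (hb : 0 < b) (s : ℂ) {η : ℝ}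
    (h : |Real.log a - Real.log b| ≤ η) (hη : ‖s‖ * η ≤ 1) :
    ‖(a : ℂ) ^ (-s) - (b : ℂ) ^ (-s)‖ ≤ a ^ (-s.re) * (2 * (‖s‖ * η)) := by
  set z : ℂ := s * ((Real.log a - Real.log b : ℝ) : ℂ) with hz
  have hzn : ‖z‖ ≤ ‖s‖ * η := by
    rw [hz, norm_mul, Complex.norm_real]
    gcongr
    exact h
  have e : (b : ℂ) ^ (-s) = (a : ℂ) ^ (-s) * Complex.exp z := by
    rw [Complex.cpow_def_of_ne_zero (by exact_mod_cast hb.ne'),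
      Complex.cpow_def_of_ne_zero (by exact_mod_cast ha.ne'), ← Complex.exp_add, hz,
      ← Complex.ofReal_log ha.le, ← Complex.ofReal_log hb.le]
    congr 1
    push_cast
    ring
  rw [e, show (a : ℂ) ^ (-s) - (a : ℂ) ^ (-s) * Complex.exp z =
    -((a : ℂ) ^ (-s) * (Complex.exp z - 1)) by ring, norm_neg, norm_mul,
    Complex.norm_cpow_eq_rpow_re_of_pos ha, Complex.neg_re]
  gcongr
  exact (Complex.norm_exp_sub_one_le (hzn.trans hη)).trans (by gcongr)

namespace UnitPartition

variable (φ : UnitPartition K)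

/-- The function `φ(log x) |N x|⁻ˢ` on the mixed space, extended by zero to the elements of
norm zero. -/
noncomputable def term (s : ℂ) (x : mixedSpace K) : ℂ :=
  open scoped Classical in
  if mixedEmbedding.norm x = 0 then 0
  else (φ.toFun (logMap x) : ℂ) * (mixedEmbedding.norm x : ℂ) ^ (-s)

/-- A bound for the spread of the logarithms of the absolute values on the support of `φ`. -/
noncomputable def spread : ℝ := Fintype.card (InfinitePlace K) * φ.bound

theorem term_of_norm_ne_zero {s : ℂ} {x : mixedSpace K} (hx : mixedEmbedding.norm x ≠ 0) :
    φ.term s x = (φ.toFun (logMap x) : ℂ) * (mixedEmbedding.norm x : ℂ) ^ (-s) :=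
  if_neg hx

@[simp]
theorem term_zero (s : ℂ) : φ.term s 0 = 0 := if_pos (map_zero _)

theorem ne_zero_of_term_ne_zero {s : ℂ} {x : mixedSpace K} (h : φ.term s x ≠ 0) :
    mixedEmbedding.norm x ≠ 0 ∧ φ.toFun (logMap x) ≠ 0 := by
  have hx : mixedEmbedding.norm x ≠ 0 := fun hx ↦ h (if_pos hx)
  refine ⟨hx, fun h0 ↦ h ?_⟩
  rw [φ.term_of_norm_ne_zero hx, h0, Complex.ofReal_zero, zero_mul]

theorem norm_pos_of_ne_zero {x : mixedSpace K} (hx : mixedEmbedding.norm x ≠ 0) :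
    0 < mixedEmbedding.norm x := (mixedEmbedding.norm_nonneg x).lt_of_ne' hx

theorem norm_term_le {s : ℂ} {x : mixedSpace K} (hx : mixedEmbedding.norm x ≠ 0) :
    ‖φ.term s x‖ ≤ mixedEmbedding.norm x ^ (-s.re) := by
  have hN := norm_pos_of_ne_zero hx
  rw [φ.term_of_norm_ne_zero hx, norm_mul, Complex.norm_cpow_eq_rpow_re_of_pos hN, Complex.norm_real,
    Complex.neg_re, Real.norm_of_nonneg (φ.nonneg _)]
  exact mul_le_of_le_one_left (by positivity) (φ.le_one _)

open scoped Classical in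
-- On the support of φ all absolute values of x agree with the n-th root of its norm up to a factor
-- exp (± spread), and ‖x‖ is the largest of them. The support thus stays away from the cone of norm
-- zero.
theorem exp_mul_norm_le {x : mixedSpace K} (hx : mixedEmbedding.norm x ≠ 0)
    (hφ : φ.toFun (logMap x) ≠ 0) :
    (Real.exp (-φ.spread) * ‖x‖) ^ Module.finrank ℚ K ≤ mixedEmbedding.norm x ∧
      ∀ w, Real.exp (-(2 * φ.spread)) * ‖x‖ ≤ normAtPlace w x := by
  have hN := norm_pos_of_ne_zero hx
  have hn := finrank_rat_pos_real (K := K)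
  have hpos : ∀ w, 0 < normAtPlace w x := fun w ↦
    (normAtPlace_nonneg w x).lt_of_ne' (mixedEmbedding.norm_ne_zero_iff.mp hx w)
  obtain ⟨v, hv⟩ := exists_normAtPlace_eq_norm x
  have hxpos : 0 < ‖x‖ := hv ▸ hpos v
  have h := abs_log_normAtPlace_sub_le hx φ.bound_nonneg (φ.abs_le_bound _ hφ)
  set ν := Real.log (mixedEmbedding.norm x) * (Module.finrank ℚ K : ℝ)⁻¹ with hν
  have h₁ := (abs_le.mp (h v)).2
  rw [hv] at h₁
  change _ ≤ φ.spread at h₁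
  constructor
  · rw [← Real.log_le_log_iff (by positivity) hN, Real.log_pow,
      Real.log_mul (Real.exp_pos _).ne' hxpos.ne', Real.log_exp]
    have : Real.log (mixedEmbedding.norm x) = Module.finrank ℚ K * ν := by
      rw [hν]; field_simp
    rw [this]
    gcongr
    linarith
  · intro w
    rw [← Real.log_le_log_iff (by positivity) (hpos w),
      Real.log_mul (Real.exp_pos _).ne' hxpos.ne', Real.log_exp]
    have h₂ := (abs_le.mp (h w)).1
    change -φ.spread ≤ _ at h₂
    linarith

end UnitPartition

end NumberField

namespace NumberField

open NumberField.Units NumberField.Units.dirichletUnitTheorem mixedEmbedding InfinitePlace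

variable {K : Type*} [Field K] [NumberField K]

theorem ofReal_pow_cpow {c : ℝ} (hc : 0 < c) (n : ℕ) (z : ℂ) :
    ((c ^ n : ℝ) : ℂ) ^ z = (c : ℂ) ^ (n * z) := by
  rw [Complex.cpow_def_of_ne_zero (by exact_mod_cast (pow_pos hc n).ne'),
    Complex.cpow_def_of_ne_zero (by exact_mod_cast hc.ne'), ← Complex.ofReal_log (by positivity),
    ← Complex.ofReal_log hc.le, Real.log_pow]
  push_cast
  ring_nf

namespace UnitPartition

variable (φ : UnitPartition K)

/-- The logarithmic vector is invariant under scaling, so only the norm contributes. -/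
theorem term_smul (s : ℂ) {c : ℝ} (hc : 0 < c) (x : mixedSpace K) :
    φ.term s (c • x) = (c : ℂ) ^ (-(Module.finrank ℚ K * s)) * φ.term s x := by
  by_cases hx : mixedEmbedding.norm x = 0
  · have hcx : mixedEmbedding.norm (c • x) = 0 := by rw [mixedEmbedding.norm_smul, hx, mul_zero]
    rw [term, term, if_pos hx, if_pos hcx, mul_zero]
  · have hcx : mixedEmbedding.norm (c • x) ≠ 0 := by
      rw [mixedEmbedding.norm_smul, abs_of_pos hc]
      exact mul_ne_zero (pow_ne_zero _ hc.ne') hx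
    rw [φ.term_of_norm_ne_zero hcx, φ.term_of_norm_ne_zero hx, logMap_real_smul hx hc.ne',
      mixedEmbedding.norm_smul, abs_of_pos hc, Complex.ofReal_mul,
      Complex.mul_cpow_ofReal_nonneg (by positivity) (mixedEmbedding.norm_nonneg x),
      ofReal_pow_cpow hc, mul_neg]
    ring

open scoped Classical in
theorem norm_term_le_norm_rpow {s : ℂ} (hs : 0 ≤ s.re) {x : mixedSpace K} (hx : x ≠ 0) :
    ‖φ.term s x‖ ≤
      (Real.exp (-φ.spread) * ‖x‖) ^ (-(Module.finrank ℚ K * s.re)) := by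
  by_cases h : φ.term s x = 0
  · rw [h, norm_zero]
    positivity
  obtain ⟨hN, hφ⟩ := φ.ne_zero_of_term_ne_zero h
  have hxpos : 0 < ‖x‖ := norm_pos_iff.mpr hx
  refine (φ.norm_term_le hN).trans ?_
  rw [neg_mul_eq_mul_neg, Real.rpow_mul (by positivity), Real.rpow_natCast]
  exact Real.rpow_le_rpow_of_nonpos (by positivity) (φ.exp_mul_norm_le hN hφ).1 (by linarith)

open scoped Classical in
/-- The terms at nearby points, one of which lies in the support. -/
theorem norm_term_sub_term_le_of_ne_zero {D : ℝ} (hD : 0 ≤ D) :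
    ∃ R C : ℝ, 1 ≤ R ∧ 0 ≤ C ∧ ∀ s : ℂ, 1 - 1 / (2 * Module.finrank ℚ K) ≤ s.re → ‖s‖ ≤ 2 →
      ∀ x y : mixedSpace K, ‖x - y‖ ≤ D → R ≤ ‖x‖ → φ.term s x ≠ 0 →
        ‖φ.term s x - φ.term s y‖ ≤ C * ‖x‖ ^ (-((Module.finrank ℚ K : ℝ) + 1 / 2)) := by
  have hn := finrank_rat_pos_real (K := K)
  set n : ℝ := (Module.finrank ℚ K : ℝ) with hndef
  have hn1 : 1 ≤ n := by
    rw [hndef]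
    exact_mod_cast (Module.finrank_pos (R := ℚ) (M := K))
  set κ := Real.exp (-(2 * φ.spread)) with hκ
  have hκ0 : 0 < κ := Real.exp_pos _
  set q := Real.exp (-φ.spread) with hq
  have hq0 : 0 < q := Real.exp_pos _
  have hlip := φ.lip_nonneg
  -- Beyond q⁻¹ the base q‖x‖ is at least 1. The summand 2D/κ keeps the absolute values of y above
  -- half the lower bound κ‖x‖ for those of x, and 4nD/κ gives ‖s‖nε ≤ 1.
  refine ⟨max 1 (max (q⁻¹) (4 * n * D / κ + 2 * D / κ)), q ^ (-(n - 1 / 2)) *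
    ((4 * φ.lip + 4 * n) * (2 * D / κ)), le_max_left _ _, by positivity, ?_⟩
  intro s hs1 hs2 x y hxy hR hne
  have hR1 : 1 ≤ ‖x‖ := (le_max_left _ _).trans hR
  have hR2 : q⁻¹ ≤ ‖x‖ := ((le_max_left _ _).trans (le_max_right _ _)).trans hR
  have hR3 : 4 * n * D / κ + 2 * D / κ ≤ ‖x‖ := ((le_max_right _ _).trans (le_max_right _ _)).trans hR
  have hxpos : 0 < ‖x‖ := zero_lt_one.trans_le hR1
  obtain ⟨hN, hφ⟩ := φ.ne_zero_of_term_ne_zero hne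
  obtain ⟨hNx, hpl⟩ := φ.exp_mul_norm_le hN hφ
  have hpos1 : 0 ≤ 4 * n * D / κ := by positivity
  have hpos2 : 0 ≤ 2 * D / κ := by positivity
  have hD' : D ≤ κ * ‖x‖ / 2 := by
    have : 2 * D / κ ≤ ‖x‖ := by linarith
    rw [div_le_iff₀ hκ0] at this
    linarith
  have hm : 0 < κ * ‖x‖ / 2 := by positivity
  have hpy : ∀ w, κ * ‖x‖ / 2 ≤ normAtPlace w y := by
    intro w
    have := (abs_le.mp ((abs_normAtPlace_sub_le x y w).trans hxy)).2
    linarith [hpl w]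
  have hpx : ∀ w, κ * ‖x‖ / 2 ≤ normAtPlace w x := fun w ↦ by linarith [hpl w]
  have hNy : mixedEmbedding.norm y ≠ 0 :=
    mixedEmbedding.norm_ne_zero_iff.mpr fun w ↦ (hm.trans_le (hpy w)).ne'
  -- Moving by D changes the logarithms by at most ε, of order 1/‖x‖. This improves the size
  -- ‖x‖^(-(n - 1/2)) of a term by one power, to an exponent below -n, hence summable over a
  -- lattice.
  set ε := 2 * D / κ / ‖x‖ with hε
  have hε0 : 0 ≤ ε := by positivity
  have hlog : ∀ w, |Real.log (normAtPlace w x) - Real.log (normAtPlace w y)| ≤ ε := by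
    intro w
    refine (abs_log_sub_log_le hm (hpx w) (hpy w)).trans ?_
    rw [div_le_iff₀ hm, hε]
    have : 2 * D / κ / ‖x‖ * (κ * ‖x‖ / 2) = D := by field_simp
    rw [this]
    exact (abs_normAtPlace_sub_le x y w).trans hxy
  have hsε : ‖s‖ * (n * ε) ≤ 1 := by
    have : n * ε ≤ 1 / 2 := by
      rw [hε, ← mul_div_assoc, div_le_iff₀ hxpos]
      have : n * (2 * D / κ) = 4 * n * D / κ / 2 := by ring
      rw [this]
      linarith
    have h0 : 0 ≤ n * ε := by positivity
    nlinarith [norm_nonneg s]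
  have hNpos := norm_pos_of_ne_zero hN
  have h₁ := norm_cpow_neg_sub_le hNpos (norm_pos_of_ne_zero hNy) s
    (abs_log_norm_sub_le hN hNy hlog) hsε
  have h₂ := φ.abs_sub_le (logMap x) (logMap y) (4 * ε) (by positivity) (abs_logMap_sub_le hN hNy hlog)
  have hpow : mixedEmbedding.norm x ^ (-s.re) ≤ (q * ‖x‖) ^ (-(n - 1 / 2)) := by
    have hqx : 1 ≤ q * ‖x‖ := by
      rwa [inv_le_iff_one_le_mul₀' hq0] at hR2
    have hsre : 1 / 2 ≤ s.re := by
      refine le_trans ?_ hs1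
      have : 1 / (2 * n) ≤ 1 / 2 := by
        apply one_div_le_one_div_of_le <;> linarith
      linarith
    calc _ ≤ ((q * ‖x‖) ^ Module.finrank ℚ K) ^ (-s.re) :=
          Real.rpow_le_rpow_of_nonpos (by positivity) hNx (by linarith)
      _ = (q * ‖x‖) ^ (n * -s.re) := by
          rw [Real.rpow_mul (by positivity), hndef, Real.rpow_natCast]
      _ ≤ _ := by
          apply Real.rpow_le_rpow_of_exponent_le hqx
          have : n * (1 - 1 / (2 * n)) ≤ n * s.re := by gcongr
          have e : n * (1 - 1 / (2 * n)) = n - 1 / 2 := by field_simp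
          linarith
  have e : φ.term s x - φ.term s y =
      ((φ.toFun (logMap x) - φ.toFun (logMap y) : ℝ) : ℂ) * (mixedEmbedding.norm x : ℂ) ^ (-s) +
      (φ.toFun (logMap y) : ℂ) * ((mixedEmbedding.norm x : ℂ) ^ (-s) -
        (mixedEmbedding.norm y : ℂ) ^ (-s)) := by
    rw [φ.term_of_norm_ne_zero hN, φ.term_of_norm_ne_zero hNy]
    push_cast
    ring
  have hN' : ‖(mixedEmbedding.norm x : ℂ) ^ (-s)‖ = mixedEmbedding.norm x ^ (-s.re) := by
    rw [Complex.norm_cpow_eq_rpow_re_of_pos hNpos, Complex.neg_re]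
  calc _ ≤ φ.lip * (4 * ε) * mixedEmbedding.norm x ^ (-s.re) +
        1 * (mixedEmbedding.norm x ^ (-s.re) * (2 * (‖s‖ * (n * ε)))) := by
        rw [e]
        refine (norm_add_le _ _).trans (add_le_add ?_ ?_)
        · rw [norm_mul, hN', Complex.norm_real, Real.norm_eq_abs]
          gcongr
        · rw [norm_mul, Complex.norm_real, Real.norm_of_nonneg (φ.nonneg _)]
          gcongr
          exact φ.le_one _
    _ = mixedEmbedding.norm x ^ (-s.re) * ((4 * φ.lip + 2 * ‖s‖ * n) * ε) := by ring
    _ ≤ (q * ‖x‖) ^ (-(n - 1 / 2)) * ((4 * φ.lip + 2 * 2 * n) * ε) := by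
        gcongr
    _ = _ := by
        rw [Real.mul_rpow hq0.le hxpos.le, hε,
          show -(n + 1 / 2) = -(n - 1 / 2) + -1 by ring, Real.rpow_add hxpos, Real.rpow_neg_one]
        ring

open scoped Classical in
-- If only y lies in the support, the two points exchange roles; then ‖y‖ ≥ ‖x‖/2, which costs the
-- factor (1/2)^ρ.
theorem norm_term_sub_term_le {D : ℝ} (hD : 0 ≤ D) :
    ∃ R C : ℝ, 1 ≤ R ∧ 0 ≤ C ∧ ∀ s : ℂ, 1 - 1 / (2 * Module.finrank ℚ K) ≤ s.re → ‖s‖ ≤ 2 →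
      ∀ x y : mixedSpace K, ‖x - y‖ ≤ D → R ≤ ‖x‖ →
        ‖φ.term s x - φ.term s y‖ ≤ C * ‖x‖ ^ (-((Module.finrank ℚ K : ℝ) + 1 / 2)) := by
  obtain ⟨R, C, hR, hC, h⟩ := φ.norm_term_sub_term_le_of_ne_zero hD
  set ρ : ℝ := -((Module.finrank ℚ K : ℝ) + 1 / 2) with hρ
  have hρ0 : ρ ≤ 0 := by rw [hρ]; linarith [finrank_rat_pos_real (K := K)]
  refine ⟨2 * R + 2 * D, C + C * (1 / 2) ^ ρ, by linarith, by positivity, ?_⟩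
  intro s hs1 hs2 x y hxy hRx
  have hxpos : 0 < ‖x‖ := by linarith
  by_cases hx : φ.term s x = 0
  · by_cases hy : φ.term s y = 0
    · rw [hx, hy, sub_zero, norm_zero]
      positivity
    · have hyx : ‖x‖ / 2 ≤ ‖y‖ := by
        have := norm_sub_norm_le x y
        linarith
      rw [norm_sub_rev]
      refine (h s hs1 hs2 y x (by rwa [norm_sub_rev]) (by linarith) hy).trans ?_
      calc C * ‖y‖ ^ ρ ≤ C * (1 / 2 * ‖x‖) ^ ρ := by
            gcongr C * ?_
            exact Real.rpow_le_rpow_of_nonpos (by positivity) (by linarith) hρ0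
        _ = C * (1 / 2) ^ ρ * ‖x‖ ^ ρ := by
            rw [Real.mul_rpow (by positivity) hxpos.le, mul_assoc]
        _ ≤ _ := by
            gcongr
            linarith
  · refine (h s hs1 hs2 x y hxy (by linarith) hx).trans ?_
    gcongr
    have : 0 ≤ C * (1 / 2) ^ ρ := by positivity
    linarith

end UnitPartition

end NumberField

/-! ### Continuation of lattice zeta functions by doubling the lattice -/

/-- A free abelian group of rank `n` is the union of the `2 ^ n` cosets of its doubles. -/
theorem exists_equiv_two_smul_add (M : Type*) [AddCommGroup M] [Module.Free ℤ M]
    [Module.Finite ℤ M] :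
    ∃ (r : (Fin (Module.finrank ℤ M) → Fin 2) → M)
      (e : M × (Fin (Module.finrank ℤ M) → Fin 2) ≃ M), ∀ p, e p = (2 : ℤ) • p.1 + r p.2 := by
  let b := Module.finBasis ℤ M
  let E : M × (Fin (Module.finrank ℤ M) → Fin 2) ≃ M :=
    (b.equivFun.toEquiv.prodCongr (Equiv.refl _)).trans <|
      (Equiv.arrowProdEquivProdArrow _ (fun _ ↦ ℤ) (fun _ ↦ Fin 2)).symm.trans <|
        (Equiv.piCongrRight fun _ ↦ (Int.divModEquiv 2).symm).trans b.equivFun.symm.toEquiv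
  refine ⟨fun v ↦ b.equivFun.symm fun i ↦ ((v i : ℕ) : ℤ), E, fun p ↦ ?_⟩
  apply b.equivFun.injective
  rw [map_add, map_smul, LinearEquiv.apply_symm_apply]
  change b.equivFun (b.equivFun.symm _) = _
  rw [LinearEquiv.apply_symm_apply]
  ext i
  change b.equivFun p.1 i * 2 + _ = 2 * b.equivFun p.1 i + _
  rw [mul_comm]
  rfl

namespace NumberField

open NumberField.Units NumberField.Units.dirichletUnitTheorem mixedEmbedding InfinitePlace

variable {K : Type*} [Field K] [NumberField K]

theorem mixedEmbedding_norm_eq_absNorm_span (x : 𝓞 K) :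
    mixedEmbedding.norm (mixedEmbedding K (x : K)) = (Ideal.absNorm (Ideal.span {x}) : ℝ) := by
  rw [mixedEmbedding.norm_eq_norm, Ideal.absNorm_span_singleton, ← Algebra.coe_norm_int,
    Nat.cast_natAbs]
  push_cast
  rfl

theorem mixedEmbedding_norm_ne_zero {x : 𝓞 K} (hx : x ≠ 0) :
    mixedEmbedding.norm (mixedEmbedding K (x : K)) ≠ 0 := by
  rw [mixedEmbedding_norm_eq_absNorm_span, Nat.cast_ne_zero, Ne, Ideal.absNorm_eq_zero_iff,
    Ideal.span_singleton_eq_bot]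
  exact hx

theorem one_le_mixedEmbedding_norm {x : 𝓞 K} (hx : x ≠ 0) :
    1 ≤ mixedEmbedding.norm (mixedEmbedding K (x : K)) := by
  have h := mixedEmbedding_norm_ne_zero hx
  rw [mixedEmbedding_norm_eq_absNorm_span] at h ⊢
  rw [Nat.cast_ne_zero] at h
  exact_mod_cast Nat.one_le_iff_ne_zero.mpr h

theorem summable_comp_of_mem {α E : Type*} {S : Set E} {g : E → ℝ} (h : Summable fun x : S ↦ g x)
    {f : α → E} (hf : Function.Injective f) (hmem : ∀ x, f x ∈ S) : Summable fun x ↦ g (f x) :=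
  h.comp_injective (i := fun x : α ↦ (⟨f x, hmem x⟩ : S))
    fun _ _ hxy ↦ hf (congrArg Subtype.val hxy)

theorem mixedEmbedding_mem_integerLattice {K : Type*} [Field K] (x : 𝓞 K) :
    mixedEmbedding K (x : K) ∈ mixedEmbedding.integerLattice K :=
  LinearMap.mem_range.mpr ⟨x, rfl⟩

theorem mixedEmbedding_coe_injective : Function.Injective fun x : 𝓞 K ↦ mixedEmbedding K (x : K) :=
  (mixedEmbedding_injective K).comp RingOfIntegers.coe_injective

open scoped Classical in
theorem summable_norm_mixedEmbedding_rpow {r : ℝ} (hr : r < -Module.finrank ℚ K) :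
    Summable fun x : 𝓞 K ↦ ‖mixedEmbedding K (x : K)‖ ^ r := by
  have h := ZLattice.summable_norm_rpow (mixedEmbedding.integerLattice K) r (by
    rwa [ZLattice.rank ℝ, mixedEmbedding.finrank])
  exact summable_comp_of_mem (S := mixedEmbedding.integerLattice K) (g := fun x ↦ ‖x‖ ^ r) h
    mixedEmbedding_coe_injective mixedEmbedding_mem_integerLattice

namespace UnitPartition

variable (φ : UnitPartition K)

theorem differentiable_term (x : mixedSpace K) : Differentiable ℂ fun s ↦ φ.term s x := by
  by_cases hx : mixedEmbedding.norm x = 0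
  · simp [term, hx]
  · simp only [φ.term_of_norm_ne_zero hx]
    intro s
    refine (DifferentiableAt.const_cpow (by fun_prop) (Or.inl ?_)).const_mul _
    exact_mod_cast hx

theorem norm_term_le_one {s : ℂ} (hs : 0 ≤ s.re) (x : 𝓞 K) :
    ‖φ.term s (mixedEmbedding K (x : K))‖ ≤ 1 := by
  by_cases hx : x = 0
  · simp [hx]
  · refine (φ.norm_term_le (mixedEmbedding_norm_ne_zero hx)).trans ?_
    exact Real.rpow_le_one_of_one_le_of_nonpos (one_le_mixedEmbedding_norm hx) (by linarith)

theorem summable_term {s : ℂ} (hs : 1 < s.re) :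
    Summable fun x : 𝓞 K ↦ φ.term s (mixedEmbedding K (x : K)) := by
  classical
  have hn := finrank_rat_pos_real (K := K)
  refine Summable.of_norm_bounded ((summable_norm_mixedEmbedding_rpow (K := K)
    (r := -(Module.finrank ℚ K * s.re)) ?_).mul_left
      (Real.exp (-φ.spread) ^ (-(Module.finrank ℚ K * s.re)))) fun x ↦ ?_
  · nlinarith
  · by_cases hx : x = 0
    · simp only [hx, map_zero, φ.term_zero, norm_zero]
      positivity
    · rw [← Real.mul_rpow (Real.exp_pos _).le (norm_nonneg _)]
      refine φ.norm_term_le_norm_rpow (by linarith) fun h ↦ hx ?_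
      exact RingOfIntegers.ext (mixedEmbedding_injective K (h.trans (map_zero _).symm))

/-- The zeta function of the lattice `J` weighted by `φ`. -/
noncomputable def zeta (J : Ideal (𝓞 K)) (s : ℂ) : ℂ :=
  ∑' x : J, φ.term s (mixedEmbedding K ((x : 𝓞 K) : K))

theorem finrank_ideal {J : Ideal (𝓞 K)} (hJ : J ≠ ⊥) :
    Module.finrank ℤ J = Module.finrank ℚ K := by
  rw [← RingOfIntegers.rank K]
  exact Ideal.finrank_eq_finrank (Module.finBasis ℤ (𝓞 K)) J hJ

/-- The zeta function of a lattice continues to the left of `1`, up to the factor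
`1 - 2 ^ (n - n * s)`. -/
theorem exists_differentiableOn_eq_zeta {J : Ideal (𝓞 K)} (hJ : J ≠ ⊥) :
    ∃ H : ℂ → ℂ,
      DifferentiableOn ℂ H {s : ℂ | 1 - 1 / (2 * (Module.finrank ℚ K : ℝ)) < s.re ∧ ‖s‖ < 2} ∧
      ∀ s : ℂ, 1 < s.re →
        H s = (1 - (2 : ℂ) ^ (Module.finrank ℚ K - Module.finrank ℚ K * s)) * φ.zeta J s := by
  classical
  have hn := finrank_rat_pos_real (K := K)
  have hn1 : (1 : ℝ) ≤ Module.finrank ℚ K := by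
    exact_mod_cast (Module.finrank_pos (R := ℚ) (M := K))
  set n : ℝ := (Module.finrank ℚ K : ℝ) with hndef
  obtain ⟨r, e, he⟩ := exists_equiv_two_smul_add J
  let μ : J → mixedSpace K := fun x ↦ mixedEmbedding K ((x : 𝓞 K) : K)
  have hμ2 : ∀ x, μ ((2 : ℤ) • x) = (2 : ℝ) • μ x := by
    intro x
    rw [two_smul, two_smul]
    exact map_add ((mixedEmbedding K).comp (algebraMap (𝓞 K) K)) (x : 𝓞 K) x
  have hμadd : ∀ x y, μ (x + y) = μ x + μ y := fun x y ↦
    map_add ((mixedEmbedding K).comp (algebraMap (𝓞 K) K)) (x : 𝓞 K) y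
  have hμ0 : ∀ x, μ x = 0 ↔ x = 0 := by
    intro x
    refine ⟨fun h ↦ Subtype.ext (RingOfIntegers.ext (mixedEmbedding_injective K
      (h.trans (map_zero _).symm))), fun h ↦ ?_⟩
    simp [h, μ]
  have hsummable : ∀ {s : ℂ}, 1 < s.re → Summable fun x : J ↦ φ.term s (μ x) := fun hs ↦
    (φ.summable_term hs).comp_injective Subtype.val_injective
  let D : ℝ := ∑ v, ‖μ (r v)‖
  have hD : ∀ v, ‖μ (r v)‖ ≤ D := fun v ↦
    Finset.single_le_sum (f := fun v ↦ ‖μ (r v)‖) (fun _ _ ↦ norm_nonneg _) (Finset.mem_univ v)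
  have hD0 : 0 ≤ D := Finset.sum_nonneg fun _ _ ↦ norm_nonneg _
  obtain ⟨R, C, hR, hC, hbound⟩ := φ.norm_term_sub_term_le hD0
  set ρ : ℝ := -(n + 1 / 2) with hρ
  -- For ‖2x‖ ≥ R the variation estimate applies. Below R each term is at most 1 in modulus, and the
  -- trivial bound 2 is at most 2 R^(-ρ) ‖2x‖^ρ. The point x = 0 is separate because the power `0 ^
  -- ρ` is 0.
  let u : J → ℝ := fun x ↦ (C + 2 * R ^ (-ρ)) * (2 ^ ρ * ‖μ x‖ ^ ρ) + if x = 0 then 2 else 0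
  have hu : Summable u := by
    refine (((summable_norm_mixedEmbedding_rpow (K := K) (r := ρ) (by rw [hρ]; linarith)
      ).comp_injective (Subtype.val_injective (p := (· ∈ J)))).mul_left _ |>.mul_left _).add ?_
    exact (hasSum_ite_eq (0 : J) (2 : ℝ)).summable
  let U : Set ℂ := {s : ℂ | 1 - 1 / (2 * n) < s.re ∧ ‖s‖ < 2}
  have hU : IsOpen U := (isOpen_lt continuous_const Complex.continuous_re).inter
    (isOpen_lt continuous_norm continuous_const)
  have hle : ∀ v x, ∀ s ∈ U,
      ‖φ.term s (μ ((2 : ℤ) • x + r v)) - φ.term s (μ ((2 : ℤ) • x))‖ ≤ u x := by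
    intro v x s hs
    have hsre : 0 ≤ s.re := by
      refine le_trans ?_ hs.1.le
      have : 1 / (2 * n) ≤ 1 := by
        rw [div_le_one (by positivity)]
        linarith
      linarith
    have htriv : ‖φ.term s (μ ((2 : ℤ) • x + r v)) - φ.term s (μ ((2 : ℤ) • x))‖ ≤ 2 := by
      refine (norm_sub_le _ _).trans ?_
      have h₁ := φ.norm_term_le_one hsre ((2 : ℤ) • x + r v : J)
      have h₂ := φ.norm_term_le_one hsre ((2 : ℤ) • x : J)
      change ‖φ.term s (μ _)‖ ≤ 1 at h₁ h₂
      linarith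
    by_cases hx : x = 0
    · refine htriv.trans ?_
      have : 0 ≤ (C + 2 * R ^ (-ρ)) * (2 ^ ρ * ‖μ x‖ ^ ρ) := by positivity
      simp only [u, if_pos hx]
      linarith
    have hxpos : 0 < ‖μ x‖ := norm_pos_iff.mpr ((hμ0 x).not.mpr hx)
    have hnorm : ‖μ ((2 : ℤ) • x)‖ = 2 * ‖μ x‖ := by
      rw [hμ2, _root_.norm_smul]
      norm_num
    simp only [u, if_neg hx, add_zero]
    rw [← Real.mul_rpow (by norm_num) hxpos.le, ← hnorm]
    have hpos : 0 < ‖μ ((2 : ℤ) • x)‖ := by rw [hnorm]; positivity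
    rcases le_or_gt R ‖μ ((2 : ℤ) • x)‖ with hRx | hRx
    · rw [norm_sub_rev]
      refine (hbound s hs.1.le hs.2.le _ _ ?_ hRx).trans ?_
      · rw [hμadd, sub_add_cancel_left, norm_neg]
        exact hD v
      · gcongr
        have : 0 ≤ R ^ (-ρ) := by positivity
        linarith
    · refine htriv.trans ?_
      have h1 : 1 ≤ R ^ (-ρ) * ‖μ ((2 : ℤ) • x)‖ ^ ρ := by
        rw [Real.rpow_neg (by positivity), ← div_eq_inv_mul, one_le_div (by positivity)]
        exact Real.rpow_le_rpow_of_nonpos hpos hRx.le (by rw [hρ]; linarith)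
      have h2 : 0 ≤ C * ‖μ ((2 : ℤ) • x)‖ ^ ρ := by positivity
      nlinarith
  -- The first terms run once over J. The second ones give 2^n times the sum over 2J, which is 2^(n
  -- - ns) times the sum over J by homogeneity.
  refine ⟨fun s ↦ ∑ v, ∑' x : J, (φ.term s (μ ((2 : ℤ) • x + r v)) - φ.term s (μ ((2 : ℤ) • x))),
    ?_, fun s hs ↦ ?_⟩
  · refine DifferentiableOn.fun_sum fun v _ ↦ ?_
    exact Complex.differentiableOn_tsum_of_summable_norm hu
      (fun x ↦ ((φ.differentiable_term _).sub (φ.differentiable_term _)).differentiableOn) hU (hle v)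
  · have hsv : ∀ v, Summable fun x : J ↦ φ.term s (μ ((2 : ℤ) • x + r v)) := fun v ↦ by
      refine ((e.summable_iff.mpr (hsummable hs)).comp_injective
        (Prod.mk_left_injective v)).congr fun x ↦ ?_
      simp only [Function.comp_apply, he]
    have h₁ : ∑ v, ∑' x : J, φ.term s (μ ((2 : ℤ) • x + r v)) = φ.zeta J s := by
      have hZ : φ.zeta J s = ∑' p, φ.term s (μ (e p)) := (e.tsum_eq fun x ↦ φ.term s (μ x)).symm
      rw [← Summable.tsum_finsetSum fun v _ ↦ hsv v, hZ,
        Summable.tsum_prod (f := fun p ↦ φ.term s (μ (e p))) (e.summable_iff.mpr (hsummable hs))]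
      refine tsum_congr fun x ↦ ?_
      rw [tsum_fintype]
      exact Finset.sum_congr rfl fun v _ ↦ by rw [he]
    have h₂ : ∀ x : J, φ.term s (μ ((2 : ℤ) • x)) =
        (2 : ℂ) ^ (-(Module.finrank ℚ K * s)) * φ.term s (μ x) := fun x ↦ by
      rw [hμ2, φ.term_smul s (by norm_num), Complex.ofReal_ofNat]
    have h₃ : Summable fun x : J ↦ φ.term s (μ ((2 : ℤ) • x)) := by
      simp only [h₂]
      exact (hsummable hs).mul_left _
    have h₄ : ∑' x : J, φ.term s (μ ((2 : ℤ) • x)) =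
        (2 : ℂ) ^ (-(Module.finrank ℚ K * s)) * φ.zeta J s := by
      simp only [h₂, tsum_mul_left, zeta, μ]
    calc _ = ∑ v, (∑' x : J, φ.term s (μ ((2 : ℤ) • x + r v)) -
          (2 : ℂ) ^ (-(Module.finrank ℚ K * s)) * φ.zeta J s) :=
          Finset.sum_congr rfl fun v _ ↦ by rw [(hsv v).tsum_sub h₃, h₄]
      _ = _ := by
          rw [Finset.sum_sub_distrib, h₁, Finset.sum_const, Finset.card_univ, Fintype.card_fun,
            Fintype.card_fin, Fintype.card_fin, finrank_ideal hJ, nsmul_eq_mul, sub_eq_add_neg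
              (Module.finrank ℚ K : ℂ), Complex.cpow_add _ _ two_ne_zero, Complex.cpow_natCast]
          push_cast
          ring

end UnitPartition

end NumberField

/-! ### From lattices to ideals, and the pole of the Dedekind zeta function -/

namespace NumberField

open NumberField.Units NumberField.Units.dirichletUnitTheorem mixedEmbedding InfinitePlace
open scoped nonZeroDivisors

variable {K : Type*} [Field K] [NumberField K]

namespace UnitPartition

variable (φ : UnitPartition K)

/-- A unit preserves the norm and translates the logarithmic vector, so the weights along an orbit
sum to 1. -/
theorem hasSum_term_unit_mul (s : ℂ) {x : 𝓞 K} (hx : x ≠ 0) :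
    HasSum (fun u : (𝓞 K)ˣ ↦ φ.term s (mixedEmbedding K ((u * x : 𝓞 K) : K)))
      ((Ideal.absNorm (Ideal.span {x}) : ℂ) ^ (-s)) := by
  have hN := mixedEmbedding_norm_ne_zero hx
  have h := (Complex.hasSum_ofReal.mpr (φ.hasSum (logMap (mixedEmbedding K (x : K))))).mul_right
    ((mixedEmbedding.norm (mixedEmbedding K (x : K)) : ℂ) ^ (-s))
  have e : (mixedEmbedding.norm (mixedEmbedding K (x : K)) : ℂ) =
      (Ideal.absNorm (Ideal.span {x}) : ℂ) := by
    rw [mixedEmbedding_norm_eq_absNorm_span, Complex.ofReal_natCast]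
  simp only [Complex.ofReal_one, one_mul] at h
  rw [e] at h
  refine h.congr_fun fun u ↦ ?_
  have hmul : mixedEmbedding K ((u * x : 𝓞 K) : K) =
      mixedEmbedding K (u : K) * mixedEmbedding K (x : K) := by
    rw [← map_mul]
    rfl
  have hux : mixedEmbedding.norm (mixedEmbedding K ((u * x : 𝓞 K) : K)) =
      mixedEmbedding.norm (mixedEmbedding K (x : K)) := by
    rw [hmul, map_mul, norm_unit, one_mul]
  rw [φ.term_of_norm_ne_zero (hux ▸ hN), hux, e, hmul,
    logMap_mul (by rw [norm_unit]; exact one_ne_zero) hN, logMap_eq_logEmbedding]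

theorem exists_span_eq_mul (J I : (Ideal (𝓞 K))⁰)
    (hI : ClassGroup.mk0 I = (ClassGroup.mk0 J)⁻¹) :
    ∃ x : 𝓞 K, x ≠ 0 ∧ Ideal.span {x} = (J * I : Ideal (𝓞 K)) := by
  have : ClassGroup.mk0 (J * I) = 1 := by rw [map_mul, hI, mul_inv_cancel]
  obtain ⟨x, hx⟩ := ((ClassGroup.mk0_eq_one_iff (J * I).2).mp this).principal
  have hx' : Ideal.span {x} = (J * I : Ideal (𝓞 K)) := hx.symm
  refine ⟨x, fun h ↦ ?_, hx'⟩
  rw [h, Ideal.span_singleton_eq_bot.mpr rfl] at hx'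
  exact nonZeroDivisors.coe_ne_zero (J * I) hx'.symm

theorem exists_mk0_eq_of_mem (J : (Ideal (𝓞 K))⁰) {y : 𝓞 K} (hy : y ∈ (J : Ideal (𝓞 K)))
    (hy0 : y ≠ 0) : ∃ I : (Ideal (𝓞 K))⁰, ClassGroup.mk0 I = (ClassGroup.mk0 J)⁻¹ ∧
      Ideal.span {y} = (J * I : Ideal (𝓞 K)) := by
  obtain ⟨I, hI⟩ := Ideal.dvd_iff_le.mpr ((Ideal.span_singleton_le_iff_mem _).mpr hy)
  have hI0 : I ≠ 0 := by
    rintro rfl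
    rw [mul_zero, Ideal.zero_eq_bot, Ideal.span_singleton_eq_bot] at hI
    exact hy0 hI
  obtain ⟨I, rfl⟩ : ∃ I' : (Ideal (𝓞 K))⁰, (I' : Ideal (𝓞 K)) = I :=
    ⟨⟨I, mem_nonZeroDivisors_of_ne_zero hI0⟩, rfl⟩
  refine ⟨I, ?_, hI⟩
  rw [eq_inv_iff_mul_eq_one, mul_comm, ← map_mul]
  refine (ClassGroup.mk0_eq_one_iff (J * I).2).mpr ?_
  rw [Submonoid.coe_mul, ← hI]
  exact ⟨⟨y, rfl⟩⟩

/-- A nonzero element of J is a unit times a chosen generator of J I, for a unique I in the inverse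
class. Summing over the units first removes the weights. -/
theorem hasSum_zeta_of_mk0_eq {s : ℂ} (hs : 1 < s.re) (J : (Ideal (𝓞 K))⁰) :
    HasSum (fun I : {I : (Ideal (𝓞 K))⁰ // ClassGroup.mk0 I = (ClassGroup.mk0 J)⁻¹} ↦
      (Ideal.absNorm (J * I.1 : Ideal (𝓞 K)) : ℂ) ^ (-s)) (φ.zeta J s) := by
  choose x hx0 hx using fun I : {I : (Ideal (𝓞 K))⁰ // ClassGroup.mk0 I = (ClassGroup.mk0 J)⁻¹} ↦
    exists_span_eq_mul J I.1 I.2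
  have hspan : ∀ I (u : (𝓞 K)ˣ), Ideal.span {(u * x I : 𝓞 K)} = (J * I.1 : Ideal (𝓞 K)) :=
    fun I u ↦ by rw [Ideal.span_singleton_mul_left_unit u.isUnit, hx]
  have hmem : ∀ I (u : (𝓞 K)ˣ), (u * x I : 𝓞 K) ∈ (J : Ideal (𝓞 K)) := fun I u ↦
    (Ideal.span_singleton_le_iff_mem _).mp ((hspan I u).le.trans Ideal.mul_le_left)
  let g : {I : (Ideal (𝓞 K))⁰ // ClassGroup.mk0 I = (ClassGroup.mk0 J)⁻¹} × (𝓞 K)ˣ →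
      (J : Ideal (𝓞 K)) := fun p ↦ ⟨p.2 * x p.1, hmem p.1 p.2⟩
  have hg : Function.Injective g := by
    rintro ⟨I, u⟩ ⟨I', u'⟩ h
    have h' : (u * x I : 𝓞 K) = u' * x I' := congrArg Subtype.val h
    have hI : I = I' := by
      have : (J * I.1 : Ideal (𝓞 K)) = (J * I'.1 : Ideal (𝓞 K)) := by
        rw [← hspan I u, ← hspan I' u', h']
      exact Subtype.ext (Subtype.ext (mul_left_cancel₀ (nonZeroDivisors.coe_ne_zero J) this))
    subst hI
    rw [Units.ext (mul_right_cancel₀ (hx0 I) h')]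
  have hrange : ∀ y ∉ Set.range g, φ.term s (mixedEmbedding K ((y : 𝓞 K) : K)) = 0 := by
    intro y hy
    by_cases hy0 : (y : 𝓞 K) = 0
    · simp [hy0]
    obtain ⟨I, hI, hyI⟩ := exists_mk0_eq_of_mem J y.2 hy0
    obtain ⟨u, hu⟩ := Ideal.span_singleton_eq_span_singleton.mp ((hx ⟨I, hI⟩).trans hyI.symm)
    exact absurd ⟨⟨⟨I, hI⟩, u⟩, Subtype.ext ((mul_comm _ _).trans hu)⟩ hy
  have hsum : HasSum (fun y : (J : Ideal (𝓞 K)) ↦ φ.term s (mixedEmbedding K ((y : 𝓞 K) : K)))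
      (φ.zeta J s) :=
    ((φ.summable_term hs).comp_injective Subtype.val_injective).hasSum
  have hfib : ∀ I, HasSum (fun u : (𝓞 K)ˣ ↦ φ.term s (mixedEmbedding K ((u * x I : 𝓞 K) : K)))
      ((Ideal.absNorm (J * I.1 : Ideal (𝓞 K)) : ℂ) ^ (-s)) := fun I ↦ by
    have h := φ.hasSum_term_unit_mul s (hx0 I)
    rwa [hx I] at h
  have hprod : HasSum (fun p : {I : (Ideal (𝓞 K))⁰ // ClassGroup.mk0 I = (ClassGroup.mk0 J)⁻¹} ×
      (𝓞 K)ˣ ↦ φ.term s (mixedEmbedding K ((p.2 * x p.1 : 𝓞 K) : K))) (φ.zeta J s) :=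
    (hg.hasSum_iff hrange).mpr hsum
  exact hprod.prod_fiberwise hfib

end UnitPartition

/-- The Dedekind zeta function as a sum over the nonzero ideals. -/
noncomputable def idealZeta (K : Type*) [Field K] [NumberField K] (s : ℂ) : ℂ :=
  ∑' I : (Ideal (𝓞 K))⁰, (Ideal.absNorm (I : Ideal (𝓞 K)) : ℂ) ^ (-s)

theorem absNorm_ne_zero (I : (Ideal (𝓞 K))⁰) : (Ideal.absNorm (I : Ideal (𝓞 K)) : ℂ) ≠ 0 :=
  Nat.cast_ne_zero.mpr (Ideal.absNorm_ne_zero_of_nonZeroDivisors I)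

/-- The class c is counted through a lattice in the inverse class; the factor N(J c)^s turns the
norm of a product J c · I into the norm of I. -/
theorem hasSum_idealZeta_aux (φ : UnitPartition K) (J : ClassGroup (𝓞 K) → (Ideal (𝓞 K))⁰)
    (hJ : ∀ c, ClassGroup.mk0 (J c) = c⁻¹) {s : ℂ} (hs : 1 < s.re) :
    HasSum (fun I : (Ideal (𝓞 K))⁰ ↦ (Ideal.absNorm (I : Ideal (𝓞 K)) : ℂ) ^ (-s))
      (∑ c, (Ideal.absNorm (J c : Ideal (𝓞 K)) : ℂ) ^ s * φ.zeta (J c) s) := by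
  classical
  have key : ∀ c, HasSum (Set.indicator {I : (Ideal (𝓞 K))⁰ | ClassGroup.mk0 I = c}
      fun I ↦ (Ideal.absNorm (I : Ideal (𝓞 K)) : ℂ) ^ (-s))
      ((Ideal.absNorm (J c : Ideal (𝓞 K)) : ℂ) ^ s * φ.zeta (J c) s) := by
    intro c
    rw [← hasSum_subtype_iff_indicator]
    have h := (φ.hasSum_zeta_of_mk0_eq hs (J c)).mul_left
      ((Ideal.absNorm (J c : Ideal (𝓞 K)) : ℂ) ^ s)
    rw [hJ, inv_inv] at h
    refine h.congr_fun fun I ↦ ?_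
    rw [map_mul, Nat.cast_mul, Complex.natCast_mul_natCast_cpow, ← mul_assoc, ← Complex.cpow_add _ _
      (absNorm_ne_zero _), add_neg_cancel, Complex.cpow_zero, one_mul]
    rfl
  refine (hasSum_sum fun c _ ↦ key c).congr_fun fun I ↦ ?_
  simp [Set.indicator_apply]

theorem summable_idealZeta {s : ℂ} (hs : 1 < s.re) :
    Summable fun I : (Ideal (𝓞 K))⁰ ↦ (Ideal.absNorm (I : Ideal (𝓞 K)) : ℂ) ^ (-s) := by
  choose J hJ using fun c : ClassGroup (𝓞 K) ↦ ClassGroup.mk0_surjective c⁻¹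
  exact (hasSum_idealZeta_aux (Classical.arbitrary (UnitPartition K)) J hJ hs).summable

theorem dedekindZeta_eq_idealZeta {s : ℂ} (hs : 1 < s.re) : dedekindZeta K s = idealZeta K s := by
  have h := (Equiv.sigmaFiberEquiv fun I : (Ideal (𝓞 K))⁰ ↦
    Ideal.absNorm (I : Ideal (𝓞 K))).hasSum_iff.mpr (summable_idealZeta hs).hasSum
  refine (h.sigma fun n ↦ ?_).tsum_eq
  rcases Nat.eq_zero_or_pos n with rfl | hn
  · have : IsEmpty {I : (Ideal (𝓞 K))⁰ // Ideal.absNorm (I : Ideal (𝓞 K)) = 0} :=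
      ⟨fun I ↦ Ideal.absNorm_ne_zero_of_nonZeroDivisors I.1 I.2⟩
    rw [LSeries.term_zero]
    exact hasSum_empty
  · have hfin := Ideal.finite_setOfPred_absNorm_eq (S := 𝓞 K) n
    let e : {I : (Ideal (𝓞 K))⁰ // Ideal.absNorm (I : Ideal (𝓞 K)) = n} ≃
        {I : Ideal (𝓞 K) // Ideal.absNorm I = n} :=
      { toFun := fun I ↦ ⟨I.1, I.2⟩
        invFun := fun I ↦ ⟨⟨I.1, mem_nonZeroDivisors_of_ne_zero fun h ↦ hn.ne' (by
          rw [← I.2, h, Ideal.zero_eq_bot, Ideal.absNorm_bot])⟩, I.2⟩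
        left_inv := fun _ ↦ rfl
        right_inv := fun _ ↦ rfl }
    have : Finite {I : Ideal (𝓞 K) // Ideal.absNorm I = n} := hfin.to_subtype
    have : Finite {I : (Ideal (𝓞 K))⁰ // Ideal.absNorm (I : Ideal (𝓞 K)) = n} := Finite.of_equiv _ e.symm
    have := Fintype.ofFinite {I : (Ideal (𝓞 K))⁰ // Ideal.absNorm (I : Ideal (𝓞 K)) = n}
    have hval : LSeries.term (fun n ↦ (Nat.card {I : Ideal (𝓞 K) // Ideal.absNorm I = n} : ℂ)) s n =
        ∑ I : {I : (Ideal (𝓞 K))⁰ // Ideal.absNorm (I : Ideal (𝓞 K)) = n},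
          (Ideal.absNorm (I.1 : Ideal (𝓞 K)) : ℂ) ^ (-s) := by
      rw [Finset.sum_congr rfl fun I _ ↦ by rw [I.2], Finset.sum_const, Finset.card_univ,
        LSeries.term_of_ne_zero hn.ne', ← Nat.card_congr e, Nat.card_eq_fintype_card, nsmul_eq_mul,
        Complex.cpow_neg, div_eq_mul_inv]
    rw [hval]
    exact hasSum_fintype _

/-- The Dedekind zeta function continues to a neighbourhood of `1`, with a simple pole at `1`. -/
theorem exists_meromorphicAt_idealZeta (K : Type*) [Field K] [NumberField K] :
    ∃ F : ℂ → ℂ, AnalyticAt ℂ F 1 ∧ F 1 ≠ 0 ∧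
      ∀ᶠ s in 𝓝[{s : ℂ | 1 < s.re}] 1, idealZeta K s = (s - 1)⁻¹ * F s := by
  obtain ⟨φ⟩ := (inferInstance : Nonempty (UnitPartition K))
  have hn := finrank_rat_pos_real (K := K)
  set n : ℝ := (Module.finrank ℚ K : ℝ) with hndef
  choose J hJ using fun c : ClassGroup (𝓞 K) ↦ ClassGroup.mk0_surjective c⁻¹
  choose H hHd hH using fun c ↦
    φ.exists_differentiableOn_eq_zeta (nonZeroDivisors.coe_ne_zero (J c))
  let U : Set ℂ := {s : ℂ | 1 - 1 / (2 * n) < s.re ∧ ‖s‖ < 2}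
  have hU : IsOpen U := (isOpen_lt continuous_const Complex.continuous_re).inter
    (isOpen_lt continuous_norm continuous_const)
  have h1U : (1 : ℂ) ∈ U := by
    refine ⟨?_, by norm_num⟩
    have : 0 < 1 / (2 * n) := by positivity
    rw [Complex.one_re]
    linarith
  let G : ℂ → ℂ := fun s ↦ ∑ c, (Ideal.absNorm (J c : Ideal (𝓞 K)) : ℂ) ^ s * H c s
  have hG : AnalyticAt ℂ G 1 := by
    refine DifferentiableOn.analyticAt (s := U) ?_ (hU.mem_nhds h1U)
    refine DifferentiableOn.fun_sum fun c _ ↦ DifferentiableOn.mul (fun s _ ↦ ?_) (hHd c)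
    exact (DifferentiableAt.const_cpow differentiableAt_id
      (Or.inl (absNorm_ne_zero _))).differentiableWithinAt
  -- The factor d has a simple zero at 1, with derivative n log 2, so `dslope d 1` is d(s)/(s - 1)
  -- with a nonzero value at 1.
  let d : ℂ → ℂ := fun s ↦ 1 - (2 : ℂ) ^ (Module.finrank ℚ K - Module.finrank ℚ K * s)
  have hd : Differentiable ℂ d := fun s ↦
    (DifferentiableAt.const_cpow (by fun_prop) (Or.inl two_ne_zero)).const_sub 1
  have hd1 : d 1 = 0 := by simp [d]
  have hd' : HasDerivAt d (Module.finrank ℚ K * Complex.log 2) 1 := by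
    have h₁ : HasDerivAt (fun s : ℂ ↦ (Module.finrank ℚ K : ℂ) - Module.finrank ℚ K * s)
        (-(Module.finrank ℚ K * 1)) 1 := ((hasDerivAt_id (1 : ℂ)).const_mul _).const_sub _
    have h₂ := (h₁.const_cpow (c := 2) (Or.inl two_ne_zero)).const_sub 1
    have e : -((2 : ℂ) ^ ((Module.finrank ℚ K : ℂ) - Module.finrank ℚ K * 1) * Complex.log 2 *
        -(Module.finrank ℚ K * 1)) = Module.finrank ℚ K * Complex.log 2 := by
      rw [mul_one, sub_self, Complex.cpow_zero]
      ring
    rwa [e] at h₂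
  have hk : AnalyticAt ℂ (dslope d 1) 1 := by
    obtain ⟨p, hp⟩ := hd.analyticAt 1
    exact ⟨_, hp.has_fpower_series_dslope_fslope⟩
  have hk1 : dslope d 1 1 ≠ 0 := by
    rw [dslope_same, hd'.deriv]
    refine mul_ne_zero (Nat.cast_ne_zero.mpr Module.finrank_pos.ne') ?_
    rw [show (2 : ℂ) = ((2 : ℝ) : ℂ) by norm_num, ← Complex.ofReal_log (by norm_num)]
    exact_mod_cast (Real.log_pos (by norm_num)).ne'
  have hmain : ∀ s : ℂ, 1 < s.re → (s - 1) * dslope d 1 s * idealZeta K s = G s := by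
    intro s hs
    have hds : (s - 1) * dslope d 1 s = d s := by
      have := sub_smul_dslope d 1 s
      rwa [hd1, sub_zero, smul_eq_mul] at this
    rw [hds, idealZeta, (hasSum_idealZeta_aux φ J hJ hs).tsum_eq, Finset.mul_sum]
    refine Finset.sum_congr rfl fun c _ ↦ ?_
    rw [hH c s hs]
    ring
  have hev : ∀ᶠ s in 𝓝[{s : ℂ | 1 < s.re}] 1,
      idealZeta K s = (s - 1)⁻¹ * (G s / dslope d 1 s) := by
    filter_upwards [nhdsWithin_le_nhds (hk.continuousAt.eventually_ne hk1), self_mem_nhdsWithin]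
      with s hs hs1
    have hs0 : s - 1 ≠ 0 := fun h ↦ by
      rw [sub_eq_zero.mp h] at hs1
      exact lt_irrefl _ hs1
    rw [← hmain s hs1]
    field_simp
  refine ⟨fun s ↦ G s / dslope d 1 s, hG.div hk hk1, ?_, hev⟩
  -- The value at 1 is the limit along the real axis from the right, which the class number formula
  -- identifies with the nonzero residue.
  have hmap : Tendsto (fun t : ℝ ↦ (t : ℂ)) (𝓝[>] 1) (𝓝[{s : ℂ | 1 < s.re}] 1) := by
    refine tendsto_nhdsWithin_iff.mpr ⟨?_, ?_⟩
    · exact (Complex.continuous_ofReal.tendsto' 1 1 Complex.ofReal_one).mono_left nhdsWithin_le_nhds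
    · filter_upwards [self_mem_nhdsWithin] with t ht
      simpa using ht
  have hlim := tendsto_sub_one_mul_dedekindZeta_nhdsGT K
  have hlim' : Tendsto (fun t : ℝ ↦ G t / dslope d 1 t) (𝓝[>] 1) (𝓝 (G 1 / dslope d 1 1)) :=
    ((hG.div hk hk1).continuousAt.tendsto.mono_left nhdsWithin_le_nhds).comp hmap
  have heq : (fun t : ℝ ↦ ((t : ℂ) - 1) * dedekindZeta K t) =ᶠ[𝓝[>] 1]
      fun t : ℝ ↦ G t / dslope d 1 t := by
    filter_upwards [hmap.eventually hev, self_mem_nhdsWithin] with t ht ht1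
    have ht0 : (t : ℂ) - 1 ≠ 0 := sub_ne_zero.mpr (by exact_mod_cast (ne_of_gt ht1))
    rw [dedekindZeta_eq_idealZeta (by simpa using ht1), ht, mul_inv_cancel_left₀ ht0]
  have := tendsto_nhds_unique (hlim.congr' heq) hlim'
  change G 1 / dslope d 1 1 ≠ 0
  rw [← this]
  exact_mod_cast dedekindZeta_residue_ne_zero K

end NumberField

/-! ### The Euler product over prime ideals -/

namespace NumberField

open scoped nonZeroDivisors

variable {K : Type*} [Field K] [NumberField K]

/-- A height one prime as a nonzero ideal. -/
def toNonZeroIdeal (P : HeightOneSpectrum (𝓞 K)) : (Ideal (𝓞 K))⁰ :=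
  ⟨P.asIdeal, mem_nonZeroDivisors_of_ne_zero P.ne_bot⟩

theorem toNonZeroIdeal_injective {K : Type*} [Field K] :
    Function.Injective (toNonZeroIdeal : HeightOneSpectrum (𝓞 K) → (Ideal (𝓞 K))⁰) :=
  fun _ _ h ↦ HeightOneSpectrum.ext (congrArg Subtype.val h)

theorem two_le_absNorm (P : HeightOneSpectrum (𝓞 K)) : 2 ≤ Ideal.absNorm P.asIdeal := by
  have h0 : Ideal.absNorm P.asIdeal ≠ 0 := Ideal.absNorm_eq_zero_iff.not.mpr P.ne_bot
  have h1 : Ideal.absNorm P.asIdeal ≠ 1 := Ideal.absNorm_eq_one_iff.not.mpr P.isPrime.ne_top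
  omega

theorem norm_absNorm_cpow (P : HeightOneSpectrum (𝓞 K)) (s : ℂ) :
    ‖(Ideal.absNorm P.asIdeal : ℂ) ^ (-s)‖ = (Ideal.absNorm P.asIdeal : ℝ) ^ (-s.re) := by
  have := two_le_absNorm P
  rw [Complex.norm_natCast_cpow_of_pos (by omega), Complex.neg_re]

theorem summable_absNorm_rpow {σ : ℝ} (hσ : 1 < σ) :
    Summable fun P : HeightOneSpectrum (𝓞 K) ↦ (Ideal.absNorm P.asIdeal : ℝ) ^ (-σ) := by
  have h := (summable_idealZeta (K := K) (s := σ) (by simpa using hσ)).norm.comp_injective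
    toNonZeroIdeal_injective
  refine h.congr fun P ↦ ?_
  exact (norm_absNorm_cpow P σ).trans (by rw [Complex.ofReal_re])

/-- The nonzero ideals that are not divisible by any prime of `S`. -/
def sieved (S : Finset (HeightOneSpectrum (𝓞 K))) : Set (Ideal (𝓞 K))⁰ :=
  {I | ∀ P ∈ S, ¬ P.asIdeal ∣ (I : Ideal (𝓞 K))}

theorem toNonZeroIdeal_mul_mem_sieved_iff {S : Finset (HeightOneSpectrum (𝓞 K))}
    {P : HeightOneSpectrum (𝓞 K)} (hP : P ∉ S) (I : (Ideal (𝓞 K))⁰) :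
    toNonZeroIdeal P * I ∈ sieved S ↔ I ∈ sieved S := by
  refine forall₂_congr fun Q hQ ↦ not_congr ?_
  change Q.asIdeal ∣ P.asIdeal * I ↔ _
  rw [Q.prime.dvd_mul, or_iff_right]
  intro h
  refine hP ?_
  have := Ideal.dvd_iff_le.mp h
  rwa [← HeightOneSpectrum.ext (P.isMaximal.eq_of_le Q.isPrime.ne_top this)] at hQ

/-- A sieve: multiplication by a new prime P maps the sieved ideals bijectively onto those divisible
by P, so the factor 1 - N(P)^(-s) deletes exactly the latter. -/
theorem prod_one_sub_mul_idealZeta {s : ℂ} (hs : 1 < s.re)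
    (S : Finset (HeightOneSpectrum (𝓞 K))) :
    (∏ P ∈ S, (1 - (Ideal.absNorm P.asIdeal : ℂ) ^ (-s))) * idealZeta K s =
      ∑' I : (Ideal (𝓞 K))⁰, (sieved S).indicator
        (fun I ↦ (Ideal.absNorm (I : Ideal (𝓞 K)) : ℂ) ^ (-s)) I := by
  classical
  induction S using Finset.induction_on with
  | empty => simp [sieved, idealZeta]
  | insert P S hP ih =>
    have hsum := summable_idealZeta (K := K) hs
    set f : (Ideal (𝓞 K))⁰ → ℂ := fun I ↦ (Ideal.absNorm (I : Ideal (𝓞 K)) : ℂ) ^ (-s)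
    have hmul : ∀ I, (sieved S).indicator f (toNonZeroIdeal P * I) =
        (Ideal.absNorm P.asIdeal : ℂ) ^ (-s) * (sieved S).indicator f I := by
      intro I
      simp only [Set.indicator_apply, toNonZeroIdeal_mul_mem_sieved_iff hP]
      split_ifs
      · change ((Ideal.absNorm (P.asIdeal * I : Ideal (𝓞 K)) : ℕ) : ℂ) ^ (-s) = _
        rw [map_mul, Nat.cast_mul, Complex.natCast_mul_natCast_cpow]
      · rw [mul_zero]
    have hinj : Function.Injective fun I ↦ toNonZeroIdeal P * I := by
      intro I J hIJ
      have h : P.asIdeal * (I : Ideal (𝓞 K)) = P.asIdeal * J := congrArg Subtype.val hIJ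
      exact Subtype.ext (mul_left_cancel₀ P.ne_bot h)
    have hrange : Set.range (fun I ↦ toNonZeroIdeal P * I) =
        {I : (Ideal (𝓞 K))⁰ | P.asIdeal ∣ (I : Ideal (𝓞 K))} := by
      ext I
      constructor
      · rintro ⟨J, rfl⟩
        exact Dvd.intro (J : Ideal (𝓞 K)) rfl
      · rintro ⟨J, hJ⟩
        refine ⟨⟨J, mem_nonZeroDivisors_of_ne_zero ?_⟩, Subtype.ext hJ.symm⟩
        rintro rfl
        exact nonZeroDivisors.coe_ne_zero I (hJ.trans (mul_zero _))
    have hS : Summable ((sieved S).indicator f) := hsum.indicator _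
    have h₁ : ∑' I, {I : (Ideal (𝓞 K))⁰ | P.asIdeal ∣ (I : Ideal (𝓞 K))}.indicator
        ((sieved S).indicator f) I =
        (Ideal.absNorm P.asIdeal : ℂ) ^ (-s) * ∑' I, (sieved S).indicator f I := by
      rw [← tsum_mul_left, ← hrange, ← tsum_subtype, tsum_range _ hinj]
      exact tsum_congr hmul
    have h₂ : ∀ I, (sieved (insert P S)).indicator f I = (sieved S).indicator f I -
        {I : (Ideal (𝓞 K))⁰ | P.asIdeal ∣ (I : Ideal (𝓞 K))}.indicator
          ((sieved S).indicator f) I := by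
      intro I
      have : I ∈ sieved (insert P S) ↔ ¬ P.asIdeal ∣ (I : Ideal (𝓞 K)) ∧ I ∈ sieved S := by
        simp [sieved]
      simp only [Set.indicator_apply, this, Set.mem_ofPred_eq]
      split_ifs <;> simp_all
    rw [Finset.prod_insert hP, mul_assoc, ih, tsum_congr h₂, hS.tsum_sub (hS.indicator _), h₁]
    ring

theorem eventually_notMem_sieved {I : (Ideal (𝓞 K))⁰} (hI : I ≠ 1) :
    ∀ᶠ S in atTop, I ∉ sieved S := by
  have hI' : (I : Ideal (𝓞 K)) ≠ ⊤ := fun h ↦ hI (Subtype.ext (h.trans Ideal.one_eq_top.symm))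
  obtain ⟨P, hP, hle⟩ := Ideal.exists_le_maximal _ hI'
  have hP0 : P ≠ ⊥ := by
    rintro rfl
    exact nonZeroDivisors.coe_ne_zero I (le_bot_iff.mp hle)
  filter_upwards [eventually_ge_atTop {⟨P, hP.isPrime, hP0⟩}] with S hS h
  exact h _ (Finset.singleton_subset_iff.mp hS) (Ideal.dvd_iff_le.mpr hle)

/-- The Euler product of the Dedekind zeta function. -/
theorem hasProd_idealZeta {s : ℂ} (hs : 1 < s.re) :
    HasProd (fun P : HeightOneSpectrum (𝓞 K) ↦ (1 - (Ideal.absNorm P.asIdeal : ℂ) ^ (-s))⁻¹)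
      (idealZeta K s) := by
  classical
  have hsum := summable_idealZeta (K := K) hs
  set f : (Ideal (𝓞 K))⁰ → ℂ := fun I ↦ (Ideal.absNorm (I : Ideal (𝓞 K)) : ℂ) ^ (-s)
  -- As S exhausts the primes only the unit ideal survives the sieve; dominated convergence gives
  -- the limit 1.
  have hlim : Tendsto (fun S : Finset (HeightOneSpectrum (𝓞 K)) ↦
      ∑' I, (sieved S).indicator f I) atTop (𝓝 1) := by
    have h := tendsto_tsum_of_dominated_convergence (𝓕 := atTop)
      (f := fun (S : Finset (HeightOneSpectrum (𝓞 K))) I ↦ (sieved S).indicator f I)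
      (g := fun I ↦ if I = 1 then 1 else 0) hsum.norm (fun I ↦ ?_)
      (Eventually.of_forall fun S I ↦ ?_)
    · rwa [tsum_ite_eq] at h
    · by_cases hI : I = 1
      · subst hI
        refine tendsto_const_nhds.congr fun S ↦ ?_
        rw [if_pos rfl, Set.indicator_of_mem]
        · simp [f]
        · intro P _ hP
          exact P.prime.not_isUnit (isUnit_of_dvd_one hP)
      · rw [if_neg hI]
        refine tendsto_const_nhds.congr' ?_
        filter_upwards [eventually_notMem_sieved hI] with S hS
        rw [Set.indicator_of_notMem hS]
    · exact norm_indicator_le_norm_self _ _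
  have h := hlim.inv₀ one_ne_zero |>.mul_const (idealZeta K s)
  rw [inv_one, one_mul] at h
  refine h.congr' ?_
  -- A nonzero sieved sum forces ζ(s) ≠ 0, which allows the cancellation below.
  filter_upwards [hlim.eventually_ne one_ne_zero] with S hS
  rw [← prod_one_sub_mul_idealZeta hs] at hS ⊢
  rw [Finset.prod_inv_distrib, mul_inv, mul_assoc, inv_mul_cancel₀ (right_ne_zero_of_mul hS),
    mul_one]

end NumberField

/-! ### Complete splitting, decomposition groups and normal closures -/

namespace NumberField

open scoped Pointwise

section Splitting

variable {K : Type*} [Field K] [NumberField K] {M : Type*} [Field M] [NumberField M] [Algebra K M]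

/-- Such primes divide the different, which is nonzero. -/
theorem finite_setOf_ramificationIdx_ne_one :
    {P : HeightOneSpectrum (𝓞 M) | P.asIdeal.ramificationIdx (𝓞 K) ≠ 1}.Finite := by
  let _ : Algebra (FractionRing (𝓞 K)) (FractionRing (𝓞 M)) := FractionRing.liftAlgebra _ _
  have : Algebra.IsSeparable (FractionRing (𝓞 K)) (FractionRing (𝓞 M)) := inferInstance
  refine (Ideal.finite_factors
    (show differentIdeal (𝓞 K) (𝓞 M) ≠ 0 from differentIdeal_ne_bot)).subset fun P hP ↦ ?_
  by_contra h
  have := not_dvd_differentIdeal_iff.mp h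
  exact hP (P.asIdeal.ramificationIdx_eq_one (𝓞 K))

theorem absNorm_under_pow (P : HeightOneSpectrum (𝓞 M)) :
    (Ideal.absNorm (P.under (𝓞 K)).asIdeal) ^ P.asIdeal.inertiaDeg (𝓞 K) =
      Ideal.absNorm P.asIdeal := by
  have := P.isPrime
  have : P.asIdeal.LiesOver (P.under (𝓞 K)).asIdeal := ⟨rfl⟩
  exact Ideal.absNorm_pow_inertiaDeg _ _

theorem card_primesOver_le (𝔭 : HeightOneSpectrum (𝓞 K)) :
    Nat.card (𝔭.asIdeal.primesOver (𝓞 M)) ≤ Module.finrank K M := by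
  have := 𝔭.isPrime
  rw [IsFractionRing.finrank_eq (𝓞 K) K (𝓞 M) M,
    ← Ideal.sum_ramification_inertia_eq_finrank (p := 𝔭.asIdeal) (S := 𝓞 M), Nat.card_eq_fintype_card,
    ← Finset.card_univ, Finset.card_eq_sum_ones]
  refine Finset.sum_le_sum fun P _ ↦ ?_
  have := P.2.1
  exact Nat.mul_pos (P.1.ramificationIdx_pos _) (P.1.inertiaDeg_pos _)

theorem card_primesOver_of_splitsCompletely {𝔭 : HeightOneSpectrum (𝓞 K)}
    (h : SplitsCompletely M 𝔭) :
    Nat.card (𝔭.asIdeal.primesOver (𝓞 M)) = Module.finrank K M := by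
  have := 𝔭.isPrime
  rw [IsFractionRing.finrank_eq (𝓞 K) K (𝓞 M) M,
    ← Ideal.sum_ramification_inertia_eq_finrank (p := 𝔭.asIdeal) (S := 𝓞 M), Nat.card_eq_fintype_card,
    ← Finset.card_univ, Finset.card_eq_sum_ones]
  refine Finset.sum_congr rfl fun P _ ↦ ?_
  rw [(h _ P.2).1, (h _ P.2).2]

/-- In a Galois extension all primes above a given one share the same ramification index and inertia
degree. -/
theorem splitsCompletely_under_iff [IsGalois K M] (P : HeightOneSpectrum (𝓞 M)) :
    SplitsCompletely M (P.under (𝓞 K)) ↔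
      P.asIdeal.ramificationIdx (𝓞 K) = 1 ∧ P.asIdeal.inertiaDeg (𝓞 K) = 1 := by
  have := P.isPrime
  have : P.asIdeal.LiesOver (P.under (𝓞 K)).asIdeal := ⟨rfl⟩
  refine ⟨fun h ↦ h _ ⟨P.isPrime, this⟩, fun h Q hQ ↦ ?_⟩
  have := hQ.1
  have := hQ.2
  rw [Ideal.ramificationIdx_eq_of_isGaloisGroup (P.under (𝓞 K)).asIdeal Q P.asIdeal Gal(M/K),
    Ideal.inertiaDeg_eq_of_isGaloisGroup (P.under (𝓞 K)).asIdeal Q P.asIdeal Gal(M/K)]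
  exact h

theorem card_stabilizer_eq_ramificationIdx_mul_inertiaDeg [IsGalois K M] (P : Ideal (𝓞 M))
    [P.IsPrime] (hP : P ≠ ⊥) :
    Nat.card (MulAction.stabilizer Gal(M/K) P) =
      P.ramificationIdx (𝓞 K) * P.inertiaDeg (𝓞 K) := by
  have hp : P.under (𝓞 K) ≠ ⊥ := mt Ideal.eq_bot_of_comap_eq_bot hP
  have : (P.under (𝓞 K)).IsPrime := inferInstance
  have : (P.under (𝓞 K)).IsMaximal := this.isMaximal hp
  have : Finite (𝓞 K ⧸ P.under (𝓞 K)) := Ideal.finiteQuotientOfFreeOfNeBot _ hp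
  have : Finite (P.under (𝓞 K)).ResidueField :=
    Finite.of_surjective _ ((P.under (𝓞 K)).bijective_algebraMap_quotient_residueField).2
  rw [Ideal.card_stabilizer_eq (G := Gal(M/K)) (P.under (𝓞 K)) P,
    Ideal.ramificationIdxIn_eq_ramificationIdx (P.under (𝓞 K)) P Gal(M/K),
    Ideal.inertiaDegIn_eq_inertiaDeg (P.under (𝓞 K)) P Gal(M/K)]

variable {L : Type*} [Field L] [NumberField L] [Algebra K L]

section Tower

variable [Algebra L M] [IsScalarTower K L M]

theorem _root_.SplitsCompletely.of_tower {𝔭 : HeightOneSpectrum (𝓞 K)} (h : SplitsCompletely M 𝔭) :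
    SplitsCompletely L 𝔭 := by
  intro 𝔮 h𝔮
  have := h𝔮.1
  have := h𝔮.2
  obtain ⟨P, hP, hPq⟩ := (inferInstance : Nonempty (𝔮.primesOver (𝓞 M)))
  have := Ideal.LiesOver.trans P 𝔮 𝔭.asIdeal
  obtain ⟨he, hf⟩ := h P ⟨hP, this⟩
  rw [Ideal.ramificationIdx_tower 𝔮 P] at he
  rw [Ideal.inertiaDeg_tower 𝔮 P] at hf
  exact ⟨Nat.eq_one_of_mul_eq_one_right he, Nat.eq_one_of_mul_eq_one_right hf⟩

/-- The decomposition group over L embeds in the one over K. Their orders are products of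
ramification index and inertia degree, which agree when the prime below in L has both equal to 1
over K; so every σ comes from Gal(M/L). -/
theorem mem_stabilizer_commutes [IsGalois K M] {P : Ideal (𝓞 M)} [P.IsPrime] (hP : P ≠ ⊥)
    (he : (P.under (𝓞 L)).ramificationIdx (𝓞 K) = 1) (hf : (P.under (𝓞 L)).inertiaDeg (𝓞 K) = 1)
    {σ : Gal(M/K)} (hσ : σ ∈ MulAction.stabilizer Gal(M/K) P) (x : L) :
    σ (algebraMap L M x) = algebraMap L M x := by
  have : IsGalois L M := IsGalois.tower_top_of_isGalois K L M
  let r : MulAction.stabilizer Gal(M/L) P → MulAction.stabilizer Gal(M/K) P := fun τ ↦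
    ⟨τ.1.restrictScalars K, by
      have h : τ.1 • P = P := τ.2
      change (τ.1.restrictScalars K) • P = P
      exact h⟩
  have hr : Function.Injective r := fun τ τ' h ↦ by
    ext y
    have := DFunLike.congr_fun (congrArg Subtype.val h) y
    exact this
  have hcard : Nat.card (MulAction.stabilizer Gal(M/K) P) ≤
      Nat.card (MulAction.stabilizer Gal(M/L) P) := by
    rw [card_stabilizer_eq_ramificationIdx_mul_inertiaDeg P hP,
      card_stabilizer_eq_ramificationIdx_mul_inertiaDeg P hP,
      Ideal.ramificationIdx_tower (R := 𝓞 K) (P.under (𝓞 L)) P,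
      Ideal.inertiaDeg_tower (R := 𝓞 K) (P.under (𝓞 L)) P, he, hf, one_mul, one_mul]
  obtain ⟨τ, hτ⟩ := (hr.bijective_of_nat_card_le hcard).2 ⟨σ, hσ⟩
  have : σ = τ.1.restrictScalars K := (congrArg Subtype.val hτ).symm
  rw [this]
  exact τ.1.commutes x

end Tower

theorem _root_.SplitsCompletely.of_isNormalClosure [IsGalois K M] (hM : IntermediateField.normalClosure K L M = ⊤)
    {𝔭 : HeightOneSpectrum (𝓞 K)} (h : SplitsCompletely L 𝔭) : SplitsCompletely M 𝔭 := by
  intro P hP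
  have := hP.1
  have := hP.2
  have hP0 : P ≠ ⊥ := Ideal.ne_bot_of_mem_primesOver 𝔭.ne_bot hP
  have hfix (f : L →ₐ[K] M) : f.fieldRange ≤
      IntermediateField.fixedField (MulAction.stabilizer Gal(M/K) P) := by
    rintro _ ⟨x, rfl⟩
    -- Each embedding f is used in turn as the L-algebra structure of M, so the previous result
    -- covers all conjugates of L.
    let : Algebra L M := f.toRingHom.toAlgebra
    have : IsScalarTower K L M := .of_algebraMap_eq fun y ↦ (f.commutes y).symm
    have : (P.under (𝓞 L)).LiesOver 𝔭.asIdeal := Ideal.LiesOver.tower_bot P _ _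
    obtain ⟨he, hf⟩ := h (P.under (𝓞 L)) ⟨inferInstance, this⟩
    rw [IntermediateField.mem_fixedField_iff]
    exact fun σ hσ ↦ mem_stabilizer_commutes hP0 he hf hσ x
  have htop : IntermediateField.fixedField (MulAction.stabilizer Gal(M/K) P) = ⊤ :=
    top_le_iff.mp (hM ▸ normalClosure_le_iff.mpr hfix)
  have hbot : MulAction.stabilizer Gal(M/K) P = ⊥ := by
    rw [← IntermediateField.fixingSubgroup_fixedField (MulAction.stabilizer Gal(M/K) P), htop,
      IntermediateField.fixingSubgroup_top]
  have := card_stabilizer_eq_ramificationIdx_mul_inertiaDeg (K := K) P hP0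
  rw [hbot, Nat.card_eq_one_iff_unique.mpr ⟨inferInstance, inferInstance⟩] at this
  exact ⟨Nat.eq_one_of_mul_eq_one_right this.symm, Nat.eq_one_of_mul_eq_one_left this.symm⟩

end Splitting

theorem splitsCompletely_iff_of_isNormalClosure (K L M : Type*) [Field K] [NumberField K] [Field L]
    [NumberField L] [Algebra K L] [Field M] [NumberField M] [Algebra K M] [h : IsNormalClosure K L M]
    (𝔭 : HeightOneSpectrum (𝓞 K)) : SplitsCompletely L 𝔭 ↔ SplitsCompletely M 𝔭 := by
  have : Normal K M := h.normal (K := L)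
  have : IsGalois K M := {}
  obtain ⟨hs, htop⟩ := Algebra.IsAlgebraic.isNormalClosure_iff.mp h
  refine ⟨fun hL ↦ hL.of_isNormalClosure htop, fun hM ↦ ?_⟩
  obtain ⟨f⟩ : Nonempty (L →ₐ[K] M) :=
    IntermediateField.nonempty_algHom_of_splits fun x ↦ ⟨Algebra.IsIntegral.isIntegral x, hs x⟩
  let : Algebra L M := f.toRingHom.toAlgebra
  have : IsScalarTower K L M := .of_algebraMap_eq fun y ↦ (f.commutes y).symm
  exact hM.of_tower

theorem finiteDimensional_of_isNormalClosure (K L M : Type*) [Field K] [Field L]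
    [Algebra K L] [FiniteDimensional K L] [Field M] [Algebra K M] [h : IsNormalClosure K L M] :
    FiniteDimensional K M := by
  have : FiniteDimensional K (IntermediateField.normalClosure K L M) :=
    normalClosure.is_finiteDimensional K L M
  rw [(Algebra.IsAlgebraic.isNormalClosure_iff.mp h).2] at this
  exact Module.Finite.equiv IntermediateField.topEquiv.toLinearEquiv

end NumberField

/-! ### Partial Euler products and the polar density -/

namespace NumberField

section EulerProduct

variable {K : Type*} [Field K] [NumberField K]

theorem absNorm_rpow_antitone (P : HeightOneSpectrum (𝓞 K)) {σ τ : ℝ} (h : σ ≤ τ) :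
    (Ideal.absNorm P.asIdeal : ℝ) ^ (-τ) ≤ (Ideal.absNorm P.asIdeal : ℝ) ^ (-σ) :=
  Real.rpow_le_rpow_of_exponent_le
    (by exact_mod_cast one_le_two.trans (two_le_absNorm P)) (neg_le_neg h)

theorem absNorm_rpow_le (P : HeightOneSpectrum (𝓞 K)) {σ : ℝ} (hσ : 1 / 2 ≤ σ) :
    (Ideal.absNorm P.asIdeal : ℝ) ^ (-σ) ≤ 3 / 4 := by
  refine (absNorm_rpow_antitone P hσ).trans ?_
  have h2 : (2 : ℝ) ≤ Ideal.absNorm P.asIdeal := by exact_mod_cast two_le_absNorm P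
  rw [Real.rpow_neg (by positivity), ← Real.sqrt_eq_rpow]
  refine inv_le_of_inv_le₀ (by norm_num) (Real.le_sqrt_of_sq_le ?_)
  norm_num
  linarith

theorem norm_log_one_sub_le {z : ℂ} (hz : ‖z‖ ≤ 3 / 4) : ‖Complex.log (1 - z)‖ ≤ 3 * ‖z‖ := by
  have h := Complex.norm_log_one_add_le (z := -z) (by rw [norm_neg]; linarith)
  rw [norm_neg, ← sub_eq_add_neg] at h
  refine h.trans ?_
  have h1 : (1 - ‖z‖)⁻¹ ≤ 4 := inv_le_of_inv_le₀ (by norm_num) (by linarith)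
  have h0 := norm_nonneg z
  nlinarith [mul_le_mul_of_nonneg_left h1 (sq_nonneg ‖z‖)]

/-- The product is the exponential of minus a normally convergent sum of logarithms. As σ ≥ 1/2,
every N(P)^(-s) has modulus at most 3/4, so 1 - N(P)^(-s) avoids the branch cut. -/
theorem exists_differentiableOn_hasProd (T : Set (HeightOneSpectrum (𝓞 K))) {σ : ℝ}
    (hσ : 1 / 2 ≤ σ) (hT : Summable fun P : T ↦ (Ideal.absNorm P.1.asIdeal : ℝ) ^ (-σ)) :
    ∃ g : ℂ → ℂ, DifferentiableOn ℂ g {s | σ < s.re} ∧ ∀ s : ℂ, σ < s.re → g s ≠ 0 ∧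
      HasProd (fun P : T ↦ (1 - (Ideal.absNorm P.1.asIdeal : ℂ) ^ (-s))⁻¹) (g s) := by
  let F : T → ℂ → ℂ := fun P s ↦ Complex.log (1 - (Ideal.absNorm P.1.asIdeal : ℂ) ^ (-s))
  have hbound (P : T) (s : ℂ) (hs : σ < s.re) :
      ‖F P s‖ ≤ 3 * (Ideal.absNorm P.1.asIdeal : ℝ) ^ (-σ) := by
    have h := norm_absNorm_cpow P.1 s
    refine (norm_log_one_sub_le (h ▸ absNorm_rpow_le P.1 (hσ.trans hs.le))).trans ?_
    rw [h]
    exact mul_le_mul_of_nonneg_left (absNorm_rpow_antitone P.1 hs.le) (by norm_num)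
  have hlt (P : T) (s : ℂ) (hs : σ < s.re) :
      ‖(Ideal.absNorm P.1.asIdeal : ℂ) ^ (-s)‖ < 1 := by
    rw [norm_absNorm_cpow]
    exact (absNorm_rpow_le P.1 (hσ.trans hs.le)).trans_lt (by norm_num)
  have hdiff (P : T) : DifferentiableOn ℂ (F P) {s | σ < s.re} := by
    have h0 : (Ideal.absNorm P.1.asIdeal : ℂ) ≠ 0 := by
      exact_mod_cast (two_pos.trans_le (two_le_absNorm P.1)).ne'
    refine DifferentiableOn.clog ?_ fun s hs ↦ ?_
    · exact (differentiableOn_const _).sub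
        (DifferentiableOn.const_cpow differentiableOn_id.neg (Or.inl h0))
    · rw [sub_eq_add_neg]
      exact Complex.mem_slitPlane_of_norm_lt_one (by rw [norm_neg]; exact hlt P s hs)
  have hopen : IsOpen {s : ℂ | σ < s.re} := isOpen_lt continuous_const Complex.continuous_re
  have hsum : Summable fun P : T ↦ 3 * (Ideal.absNorm P.1.asIdeal : ℝ) ^ (-σ) := hT.mul_left 3
  refine ⟨fun s ↦ Complex.exp (-∑' P, F P s), ?_, fun s hs ↦ ⟨Complex.exp_ne_zero _, ?_⟩⟩
  · exact (Complex.differentiableOn_tsum_of_summable_norm hsum hdiff hopen hbound).neg.cexp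
  · have hs' : HasSum (fun P ↦ F P s) (∑' P, F P s) :=
      (Summable.of_norm_bounded hsum fun P ↦ hbound P s hs).hasSum
    convert hs'.neg.cexp using 2 with P
    have h0 : 1 - (Ideal.absNorm P.1.asIdeal : ℂ) ^ (-s) ≠ 0 := fun h ↦ by
      have := hlt P s hs
      rw [← sub_eq_zero.mp h, norm_one] at this
      exact lt_irrefl _ this
    rw [Function.comp_apply, Complex.exp_neg, Complex.exp_log h0]

end EulerProduct

section Fibers

variable {K : Type*} [Field K] [NumberField K] {M : Type*} [Field M] [NumberField M] [Algebra K M]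

/-- The nonzero primes of `𝓞 M` with pullback `𝔭` are the primes over `𝔭`. -/
def fiberEquivPrimesOver (𝔭 : HeightOneSpectrum (𝓞 K)) :
    {P : HeightOneSpectrum (𝓞 M) // P.under (𝓞 K) = 𝔭} ≃ 𝔭.asIdeal.primesOver (𝓞 M) where
  toFun P := ⟨P.1.asIdeal, P.1.isPrime, ⟨(congrArg HeightOneSpectrum.asIdeal P.2).symm⟩⟩
  invFun Q := ⟨⟨Q.1, Q.2.1, Ideal.ne_bot_of_mem_primesOver 𝔭.ne_bot Q.2⟩,
    HeightOneSpectrum.ext Q.2.2.over.symm⟩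
  left_inv _ := rfl
  right_inv _ := rfl

instance (𝔭 : HeightOneSpectrum (𝓞 K)) :
    Finite {P : HeightOneSpectrum (𝓞 M) // P.under (𝓞 K) = 𝔭} :=
  have := 𝔭.isPrime
  Finite.of_equiv _ (fiberEquivPrimesOver 𝔭).symm

theorem summable_absNorm_under_rpow {σ : ℝ} (hσ : 1 < σ) :
    Summable fun P : HeightOneSpectrum (𝓞 M) ↦
      (Ideal.absNorm (P.under (𝓞 K)).asIdeal : ℝ) ^ (-σ) := by
  rw [← (Equiv.sigmaFiberEquiv fun P : HeightOneSpectrum (𝓞 M) ↦ P.under (𝓞 K)).summable_iff,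
    summable_sigma_of_nonneg fun P ↦ by exact Real.rpow_nonneg (Nat.cast_nonneg _) _]
  refine ⟨fun _ ↦ Summable.of_finite, ?_⟩
  refine Summable.of_nonneg_of_le (fun _ ↦ tsum_nonneg fun _ ↦ Real.rpow_nonneg (Nat.cast_nonneg _) _) (fun 𝔭 ↦ ?_)
    ((summable_absNorm_rpow (K := K) hσ).mul_left (Module.finrank K M : ℝ))
  have h (P : {P : HeightOneSpectrum (𝓞 M) // P.under (𝓞 K) = 𝔭}) :
      (Ideal.absNorm (P.1.under (𝓞 K)).asIdeal : ℝ) ^ (-σ) =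
        (Ideal.absNorm 𝔭.asIdeal : ℝ) ^ (-σ) := by rw [P.2]
  simp only [Function.comp_apply, Equiv.sigmaFiberEquiv_apply, h, tsum_const, nsmul_eq_mul]
  refine mul_le_mul_of_nonneg_right ?_ (by positivity)
  rw [Nat.card_congr (fiberEquivPrimesOver 𝔭)]
  exact_mod_cast card_primesOver_le 𝔭

variable (K M) in
/-- The nonzero primes of `𝓞 M` of ramification index and inertia degree `1` over `K`. -/
def degreeOnePrimes : Set (HeightOneSpectrum (𝓞 M)) :=
  {P | P.asIdeal.ramificationIdx (𝓞 K) = 1 ∧ P.asIdeal.inertiaDeg (𝓞 K) = 1}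

/-- Only finitely many primes ramify. One of inertia degree at least 2 above 𝔭 has norm at least
N(𝔭)^2, so its term is at most N(𝔭)^(-3/2), and at most [M:K] primes lie above each 𝔭. -/
theorem summable_absNorm_rpow_compl_degreeOnePrimes :
    Summable fun P : ↑(degreeOnePrimes K M)ᶜ ↦ (Ideal.absNorm P.1.asIdeal : ℝ) ^ (-(3 / 4) : ℝ) := by
  set g : HeightOneSpectrum (𝓞 M) → ℝ := fun P ↦ (Ideal.absNorm P.asIdeal : ℝ) ^ (-(3 / 4) : ℝ)
  have hg (P) : 0 ≤ g P := by positivity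
  change Summable (g ∘ (Subtype.val : ↑(degreeOnePrimes K M)ᶜ → _))
  rw [summable_subtype_iff_indicator]
  have h₁ : Summable
      ({P : HeightOneSpectrum (𝓞 M) | P.asIdeal.ramificationIdx (𝓞 K) ≠ 1}.indicator g) :=
    summable_subtype_iff_indicator.mp (finite_setOf_ramificationIdx_ne_one.summable g)
  refine Summable.of_nonneg_of_le (fun P ↦ Set.indicator_nonneg (fun P _ ↦ hg P) P) (fun P ↦ ?_)
    (h₁.add (summable_absNorm_under_rpow (K := K) (M := M) (σ := 3 / 2) (by norm_num)))
  have hu : 0 ≤ (Ideal.absNorm (P.under (𝓞 K)).asIdeal : ℝ) ^ (-(3 / 2) : ℝ) := by positivity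
  by_cases he : P.asIdeal.ramificationIdx (𝓞 K) = 1
  · rw [Set.indicator_of_notMem (s := {P : HeightOneSpectrum (𝓞 M) | P.asIdeal.ramificationIdx (𝓞 K) ≠ 1}) (by simpa using he),
      zero_add]
    by_cases hf : P.asIdeal.inertiaDeg (𝓞 K) = 1
    · rw [Set.indicator_of_notMem (s := (degreeOnePrimes K M)ᶜ) (fun h ↦ h ⟨he, hf⟩)]
      exact hu
    · rw [Set.indicator_of_mem (s := (degreeOnePrimes K M)ᶜ) (fun h ↦ hf h.2)]
      have := P.isPrime
      have hf2 : 2 ≤ P.asIdeal.inertiaDeg (𝓞 K) := by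
        have := P.asIdeal.inertiaDeg_pos (𝓞 K)
        omega
      have h1 : (1 : ℝ) ≤ Ideal.absNorm (P.under (𝓞 K)).asIdeal := by
        exact_mod_cast one_le_two.trans (two_le_absNorm _)
      have hle : (Ideal.absNorm (P.under (𝓞 K)).asIdeal : ℝ) ^ (2 : ℝ) ≤
          Ideal.absNorm P.asIdeal := by
        rw [← absNorm_under_pow (K := K) P, Nat.cast_pow, Real.rpow_ofNat]
        exact pow_le_pow_right₀ h1 hf2
      calc g P ≤ ((Ideal.absNorm (P.under (𝓞 K)).asIdeal : ℝ) ^ (2 : ℝ)) ^ (-(3 / 4) : ℝ) :=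
            Real.rpow_le_rpow_of_nonpos (by positivity) hle (by norm_num)
        _ = (Ideal.absNorm (P.under (𝓞 K)).asIdeal : ℝ) ^ (-(3 / 2) : ℝ) := by
            rw [← Real.rpow_mul (by positivity)]
            norm_num
  · rw [Set.indicator_of_mem (s := {P : HeightOneSpectrum (𝓞 M) | P.asIdeal.ramificationIdx (𝓞 K) ≠ 1}) he]
    exact (Set.indicator_le_self' (fun P _ ↦ hg P) P).trans (le_add_of_nonneg_right hu)

/-- The primes of `𝓞 M` of ramification index and inertia degree `1`, sorted according to the
completely split primes below them. -/
def splitFiberEquiv [IsGalois K M] :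
    (Σ 𝔭 : {𝔭 : HeightOneSpectrum (𝓞 K) | SplitsCompletely M 𝔭},
      {P : HeightOneSpectrum (𝓞 M) // P.under (𝓞 K) = 𝔭.1}) ≃
    degreeOnePrimes K M where
  toFun x := ⟨x.2.1, (splitsCompletely_under_iff x.2.1).mp (x.2.2.symm ▸ x.1.2)⟩
  invFun P := ⟨⟨P.1.under (𝓞 K), (splitsCompletely_under_iff P.1).mpr P.2⟩, ⟨P.1, rfl⟩⟩
  left_inv := by
    rintro ⟨⟨𝔭, h⟩, ⟨P, hP⟩⟩
    obtain rfl : P.under (𝓞 K) = 𝔭 := hP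
    rfl
  right_inv _ := rfl

/-- Grouping by the prime below, each completely split 𝔭 has exactly [M:K] primes above it, all of
norm N(𝔭). -/
theorem hasProd_split [IsGalois K M] {s : ℂ} (hs : 1 < s.re) :
    HasProd (fun P : degreeOnePrimes K M ↦ (1 - (Ideal.absNorm P.1.asIdeal : ℂ) ^ (-s))⁻¹)
      (partialDedekindZeta {𝔭 : HeightOneSpectrum (𝓞 K) | SplitsCompletely M 𝔭} s ^
        Module.finrank K M) := by
  obtain ⟨σ, hσ, hσs⟩ := exists_between hs
  obtain ⟨g, -, hg⟩ := exists_differentiableOn_hasProd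
    (degreeOnePrimes K M) (by linarith)
    ((summable_absNorm_rpow hσ).subtype _)
  obtain ⟨g', -, hg'⟩ := exists_differentiableOn_hasProd
    {𝔭 : HeightOneSpectrum (𝓞 K) | SplitsCompletely M 𝔭} (by linarith)
    ((summable_absNorm_rpow hσ).subtype _)
  have hA := (hg' s hσs).2
  have hP := (hg s hσs).2
  have hfib := ((splitFiberEquiv (K := K) (M := M)).hasProd_iff.mpr hP).sigma
    (g := fun 𝔭 ↦ ((1 - (Ideal.absNorm 𝔭.1.asIdeal : ℂ) ^ (-s))⁻¹) ^ Module.finrank K M)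
    fun 𝔭 ↦ by
      have : Fintype {P : HeightOneSpectrum (𝓞 M) // P.under (𝓞 K) = 𝔭.1} := Fintype.ofFinite _
      have h (P : {P : HeightOneSpectrum (𝓞 M) // P.under (𝓞 K) = 𝔭.1}) :
          (1 - (Ideal.absNorm P.1.asIdeal : ℂ) ^ (-s))⁻¹ =
            (1 - (Ideal.absNorm 𝔭.1.asIdeal : ℂ) ^ (-s))⁻¹ := by
        have hsplit := ((splitsCompletely_under_iff P.1).mp (P.2.symm ▸ 𝔭.2)).2
        rw [← absNorm_under_pow (K := K) P.1, hsplit, pow_one, P.2]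
      have hfin := hasProd_fintype
        (fun P : {P : HeightOneSpectrum (𝓞 M) // P.under (𝓞 K) = 𝔭.1} ↦
          (1 - (Ideal.absNorm P.1.asIdeal : ℂ) ^ (-s))⁻¹)
      rw [Finset.prod_congr rfl fun P _ ↦ h P, Finset.prod_const, Finset.card_univ,
        ← Nat.card_eq_fintype_card, Nat.card_congr (fiberEquivPrimesOver 𝔭.1),
        card_primesOver_of_splitsCompletely 𝔭.2] at hfin
      exact hfin
  have hpow := hA.pow (Module.finrank K M)
  rw [partialDedekindZeta, hA.tprod_eq, ← hfib.unique hpow]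
  exact hP

theorem hasPolarDensity_splitsCompletely (K M : Type*) [Field K] [NumberField K] [Field M]
    [NumberField M] [Algebra K M] [IsGalois K M] :
    HasPolarDensity {𝔭 : HeightOneSpectrum (𝓞 K) | SplitsCompletely M 𝔭}
      (1 / (Module.finrank K M : ℚ)) := by
  obtain ⟨F, hF, hF1, hFs⟩ := exists_meromorphicAt_idealZeta M
  obtain ⟨h, hh, hprod⟩ := exists_differentiableOn_hasProd _ (by norm_num)
    (summable_absNorm_rpow_compl_degreeOnePrimes (K := K) (M := M))
  have hopen : IsOpen {s : ℂ | (3 / 4 : ℝ) < s.re} :=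
    isOpen_lt continuous_const Complex.continuous_re
  have h1mem : (1 : ℂ) ∈ {s : ℂ | (3 / 4 : ℝ) < s.re} := by norm_num
  have hh1 : AnalyticAt ℂ h 1 := hh.analyticAt (hopen.mem_nhds h1mem)
  have hne : h 1 ≠ 0 := (hprod 1 h1mem).1
  have hG : AnalyticAt ℂ (fun s ↦ F s / h s) 1 := hF.div hh1 hne
  have hmer : MeromorphicAt (fun s ↦ (s - 1)⁻¹ * (F s / h s)) 1 :=
    ((analyticAt_id.sub analyticAt_const).meromorphicAt.inv).mul hG.meromorphicAt
  -- The [M:K]-th power equals ζ_M / h, whose pole is simple: hence n = [M:K] and m = 1.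
  refine ⟨Module.finrank K M, 1, Module.finrank_pos, by simp,
    fun s ↦ (s - 1)⁻¹ * (F s / h s), hmer, ?_, ?_⟩
  · rw [meromorphicOrderAt_eq_int_iff hmer]
    refine ⟨fun s ↦ F s / h s, hG, div_ne_zero hF1 hne, .of_forall fun s ↦ ?_⟩
    simp
  · filter_upwards [hFs, self_mem_nhdsWithin] with s hs hs1
    have hs1 : 1 < s.re := hs1
    obtain ⟨hhs, hph⟩ := hprod s (by linarith)
    have hmul := HasProd.mul_compl (s := degreeOnePrimes K M)
      (f := fun P : HeightOneSpectrum (𝓞 M) ↦ (1 - (Ideal.absNorm P.asIdeal : ℂ) ^ (-s))⁻¹)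
      (hasProd_split hs1) hph
    have := (hasProd_idealZeta (K := M) hs1).unique hmul
    rw [hs] at this
    rw [mul_div_assoc', this, mul_div_cancel_right₀ _ hhs]

end Fibers

end NumberField

theorem corollary1 (K L M : Type*) [Field K] [NumberField K] [Field L] [NumberField L]
    [Algebra K L] [Field M] [Algebra K M] [IsNormalClosure K L M] :
    HasPolarDensity {𝔭 : HeightOneSpectrum (𝓞 K) | SplitsCompletely M 𝔭}
        (1 / (Module.finrank K M : ℚ)) ∧
      {𝔭 : HeightOneSpectrum (𝓞 K) | SplitsCompletely L 𝔭} =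
        {𝔭 : HeightOneSpectrum (𝓞 K) | SplitsCompletely M 𝔭} := by
  have : Normal K M := IsNormalClosure.normal (K := L)
  have : IsGalois K M := {}
  have : FiniteDimensional K M := NumberField.finiteDimensional_of_isNormalClosure K L M
  have : NumberField M := .of_module_finite K M
  exact ⟨NumberField.hasPolarDensity_splitsCompletely K M,
    Set.ext fun 𝔭 ↦ NumberField.splitsCompletely_iff_of_isNormalClosure K L M 𝔭⟩
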